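/- Let $p$ be a prime and let $k$ be a finite field of characteristic $p$, with ring of $p$-typical Witt vectors $W(k)$. A \emph{frame} $\underline S=(S,\sigma,\tau)$ consists of a $\mathbb Z$-graded commutative ring $S=\bigoplus_{n\in\mathbb Z}S_n$ and ring homomorphisms $\sigma,\tau:S\to S_0$ such that: $\tau|_{S_0}=\mathrm{id}$ and $\tau:S_{-n}\to S_0$ is bijective for all $n\ge 1$; $\sigma|_{S_0}$ is a Frobenius lift (i.e. $\sigma(a)\equiv a^p$ modulo $pS_0$ for $a\in S_0$) and $\sigma(t)=p$, where $t\in S_{-1}$ is the unique element with $\tau(t)=1$; and $p$ lies in the Jacobson radical of $S_0$. It is a \emph{frame over $W(k)$} if $S$ is a graded $W(k)$-algebra and $\sigma$ extends the Frobenius of $W(k)$. Let $(G,\mu)$ be a \emph{display datum}, i.e. $G=\operatorname{Spec}A'$ is a smooth affine group scheme (of finite type) over $\mathbb Z_p$ and $\mu:\mathbb G_m\to G_{W(k)}$ is a cocharacter over $W(k)$. Put $A=W(k)\otimes_{\mathbb Z_p}A'$, so that $G_{W(k)}=\operatorname{Spec}A$. The action $g*\lambda=\mu(\lambda)^{-1}g\mu(\lambda)$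 of $\mathbb G_m$ on $G_{W(k)}$ defines a grading $A=\bigoplus_{n\in\mathbb Z}A_n$, where $A_n$ consists of the $f\in A$ with $f(g*\lambda)=\lambda^nf(g)$. Let $P^-\subseteq G_{W(k)}$ and $P^+\subseteq G_{W(k)}$ be the closed subgroup schemes defined by the ideals $(A_{>0})$ and $(A_{<0})$ generated by the elements of positive, respectively negative, degree. Let $L=P^+\cap P^-$; its coordinate ring is the degree zero part of $A/(A_{<0})$, and the inclusion of this degree zero part defines a homomorphism $P^+\to L$. Let $U^+$ be its kernel. For a graded $W(k)$-algebra $S$ let $G(S)_\mu\subseteq G_{W(k)}(S)$ be the group of $\mathbb G_m$-equivariant $S$-points, i.e. of homomorphisms of graded $W(k)$-algebras $A\to S$, and for a $\mathbb G_m$-stable closed subgroup scheme $H\subseteq G_{W(k)}$ let $H(S)_\mu=H(S)\cap G(S)_\mu$. Then for every display datum $(G,\mu)$ and every frame $\underline S=(S,\sigma,\tau)$ over $W(k)$, the multiplication map $$P^-(S)_\mu\times U^+(S)_\mu\to G(S)_\mu,\qquad (q,h)\mapsto qh,$$ is bijective. -/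

import Mathlib

open scoped TensorProduct LaurentPolynomial

noncomputable section

namespace GDisplay

/-! ### The `ℤ_p`-algebra `W(k)` -/

/-- For a ring `k` of characteristic `p`, the ring `W(k)` is a `ℤ_p`-algebra via
`ℤ_p ≅ W(𝔽_p) → W(k)`. -/
instance wittAlgebra (p : ℕ) [Fact p.Prime] (k : Type*) [CommRing k] [CharP k p] :
    Algebra ℤ_[p] (WittVector p k) :=
  ((WittVector.map (ZMod.castHom (dvd_refl p) k)).comp
    (WittVector.equiv p).symm.toRingHom).toAlgebra

/-! ### Frames -/

section Frame

variable {S E : Type*} [CommRing S] [SetLike E S] [AddSubgroupClass E S]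

/-- A pre-frame structure on a `ℤ`-graded ring `S = ⨁ Sₙ`: ring homomorphisms
`σ, τ : S → S₀`. -/
structure PreFrame (𝒮 : ℤ → E) [GradedRing 𝒮] where
  σ : S →+* 𝒮 0
  τ : S →+* 𝒮 0

/-- The axioms for a pre-frame to be a (higher) frame with respect to the prime `p`. -/
structure PreFrame.IsFrame (p : ℕ) {𝒮 : ℤ → E} [GradedRing 𝒮] (F : PreFrame 𝒮) : Prop where
  /-- `τ₀` is the identity of `S₀`. -/
  τ_zero : ∀ a : 𝒮 0, F.τ (a : S) = a
  /-- `τ₋ₙ : S₋ₙ → S₀` is bijective for `n ≥ 1`. -/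
  τ_neg_bijective : ∀ n : ℕ, 1 ≤ n →
    Function.Bijective (fun a : 𝒮 (-(n : ℤ)) => F.τ (a : S))
  /-- `σ₀` is a Frobenius lift: `σ₀(a) ≡ a ^ p` modulo `p S₀`. -/
  σ_frobenius : ∀ a : 𝒮 0, F.σ (a : S) - a ^ p ∈ Ideal.span {(p : 𝒮 0)}
  /-- The (unique) element `t ∈ S₋₁` with `τ(t) = 1` satisfies `σ(t) = p`. -/
  σ_t : ∃ t : 𝒮 (-1), F.τ (t : S) = 1 ∧ F.σ (t : S) = p
  /-- `p` lies in the Jacobson radical of `S₀`. -/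
  p_mem_rad : (p : 𝒮 0) ∈ Ideal.jacobson (⊥ : Ideal (𝒮 0))

end Frame

/-- A frame over `W(k)`: a frame whose underlying graded ring is a graded `W(k)`-algebra, such
that `σ` extends the Frobenius of `W(k)`. -/
structure PreFrame.IsFrameOverWitt (p : ℕ) [Fact p.Prime] {k : Type*} [CommRing k] [CharP k p]
    {S : Type*} [CommRing S] [Algebra (WittVector p k) S]
    {𝒮 : ℤ → Submodule (WittVector p k) S} [GradedAlgebra 𝒮] (F : PreFrame 𝒮) : Prop
    extends F.IsFrame p where
  σ_algebraMap : ∀ w : WittVector p k,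
    (F.σ (algebraMap (WittVector p k) S w) : S) =
      algebraMap (WittVector p k) S (WittVector.frobenius w)

/-! ### Weights for the conjugation action of a cocharacter

Here `G = Spec A` is an affine group scheme over a ring `W`, and a cocharacter `μ : 𝔾ₘ → G` is
given by the corresponding homomorphism of bialgebras `A → W[T, T⁻¹]`. -/

section Weights

variable {W : Type*} [CommRing W] {A : Type*} [CommRing A] [HopfAlgebra W A]

/-- The coaction `A → A ⊗ W[T, T⁻¹]` of the right action `(g, λ) ↦ μ(λ)⁻¹ g μ(λ)` of `𝔾ₘ` on
`G = Spec A`. It is the product `μ(T)⁻¹ · g · μ(T)` in `G(A ⊗ W[T, T⁻¹])`, where `g` denotes the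
universal point of `G`; the convolution product on `WithConv (A →ₐ[W] B)` is the group law
of `G(B)`, and inversion in `G` is given by the antipode. -/
def conjCoaction (μ : A →ₐc[W] W[T;T⁻¹]) : A →ₐ[W] A ⊗[W] W[T;T⁻¹] :=
  let m : A →ₐ[W] A ⊗[W] W[T;T⁻¹] :=
    (Algebra.TensorProduct.includeRight : W[T;T⁻¹] →ₐ[W] A ⊗[W] W[T;T⁻¹]).comp
      (μ : A →ₐ[W] W[T;T⁻¹])
  let g : A →ₐ[W] A ⊗[W] W[T;T⁻¹] := Algebra.TensorProduct.includeLeft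
  (WithConv.toConv (m.comp (HopfAlgebra.antipodeAlgHom W A)) * WithConv.toConv g *
    WithConv.toConv m).ofConv

/-- The weight space `Aₙ`: all `f ∈ A` with `f(μ(λ)⁻¹ g μ(λ)) = λⁿ f(g)`. -/
def weightSpace (μ : A →ₐc[W] W[T;T⁻¹]) (n : ℤ) : Submodule W A where
  carrier := {f | conjCoaction μ f = f ⊗ₜ[W] LaurentPolynomial.T n}
  add_mem' := by
    intro a b ha hb
    simp only [Set.mem_ofPred_eq] at *
    rw [map_add, ha, hb, TensorProduct.add_tmul]
  zero_mem' := by simp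
  smul_mem' := by
    intro c a ha
    simp only [Set.mem_ofPred_eq] at *
    rw [map_smul, ha, TensorProduct.smul_tmul']

/-- The ideal `(A_{>0})` defining the subgroup scheme `P⁻ ⊆ G`. -/
def idealPMinus (μ : A →ₐc[W] W[T;T⁻¹]) : Ideal A :=
  Ideal.span {f | ∃ n : ℤ, 0 < n ∧ f ∈ weightSpace μ n}

/-- The ideal `(A_{<0})` defining the subgroup scheme `P⁺ ⊆ G`. -/
def idealPPlus (μ : A →ₐc[W] W[T;T⁻¹]) : Ideal A :=
  Ideal.span {f | ∃ n : ℤ, n < 0 ∧ f ∈ weightSpace μ n}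

/-- The ideal defining `U⁺ = Ker(P⁺ → L)`. The coordinate ring of `L` is the degree zero part of
`A⁺ = A / (A_{<0})`, which is the image of `A₀`, and `P⁺ → L` is given by the inclusion
`(A⁺)₀ → A⁺`. Hence the kernel is cut out in `P⁺` by the elements `f - ε(f)` with `f ∈ A₀`,
where `ε` is the counit. -/
def idealUPlus (μ : A →ₐc[W] W[T;T⁻¹]) : Ideal A :=
  idealPPlus μ ⊔ Ideal.span
    {f | ∃ a ∈ weightSpace μ 0, f = a - algebraMap W A (Coalgebra.counit (R := W) a)}

variable {S : Type*} [CommRing S] [Algebra W S]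

/-- The display group `G(S)_μ`: the points of `G(S)` given by homomorphisms of graded algebras
`A → S`, that is, the `𝔾ₘ`-equivariant morphisms `Spec S → G`. -/
def displayGroup (μ : A →ₐc[W] W[T;T⁻¹]) (𝒮 : ℤ → Submodule W S) : Set (WithConv (A →ₐ[W] S)) :=
  {g | ∀ n : ℤ, ∀ f ∈ weightSpace μ n, g.ofConv f ∈ 𝒮 n}

/-- For a closed subscheme `H ⊆ G` defined by an ideal `I` of `A`, stable under the action of
`𝔾ₘ`, the set `H(S)_μ` of `𝔾ₘ`-equivariant morphisms `Spec S → H`, as a subset of `G(S)`. -/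
def equivariantPoints (μ : A →ₐc[W] W[T;T⁻¹]) (𝒮 : ℤ → Submodule W S) (I : Ideal A) :
    Set (WithConv (A →ₐ[W] S)) :=
  {g | g ∈ displayGroup μ 𝒮 ∧ ∀ f ∈ I, g.ofConv f = 0}

/-- `P⁻(S)_μ`. -/
def PMinus (μ : A →ₐc[W] W[T;T⁻¹]) (𝒮 : ℤ → Submodule W S) : Set (WithConv (A →ₐ[W] S)) :=
  equivariantPoints μ 𝒮 (idealPMinus μ)

/-- `U⁺(S)_μ`. -/
def UPlus (μ : A →ₐc[W] W[T;T⁻¹]) (𝒮 : ℤ → Submodule W S) : Set (WithConv (A →ₐ[W] S)) :=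
  equivariantPoints μ 𝒮 (idealUPlus μ)

end Weights

end GDisplay

end

/-!
The multiplication `P⁻ × U⁺ → G` is a monomorphism because `P⁻ ∩ U⁺` is trivial. It is smooth: a
point of `G` that is infinitesimally close to the unit section is given by a derivation, whose
components of weight `≤ 0` and of weight `> 0` yield its factors in `P⁻` and in `U⁺`.

Let `g` be an equivariant point of `G` over a frame `S`. The pullback of `P⁻ × U⁺ → G` along `g`
is given by a flat epimorphism `S → C`, and `𝔾ₘ` acts on `Spec C`. The annihilators of homogeneous
elements of the kernel and of the cokernel of `S → C` are homogeneous ideals of `S` that generate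
the unit ideal of `C`. Let `I` be such an ideal. On the fixed points of `Spec S` the point `g` lies
in `P⁻`, so they map to `Spec C`, and hence `I` together with the elements of nonzero degree
generates the unit ideal of `S`. In a frame, `Sₙ S₋ₙ` with `n ≠ 0` lies in the Jacobson radical of
`S₀`: every `b ∈ S₋ₙ` with `n > 0` is a multiple of `tⁿ`, and for `a ∈ Sₙ` the Frobenius lift maps
`a tⁿ` to a multiple of `p`. Thus `I` contains a unit. It follows that `S = C`, so that `g = qh`
with `q ∈ P⁻(S)` and `h ∈ U⁺(S)`; as the factors are unique, they are equivariant.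
-/

noncomputable section

namespace GDisplay

open WithConv (toConv)

/-! ### Gradings and coactions of `𝔾ₘ` -/

section Laurent

variable {R X : Type*} [CommRing R] [CommRing X] [Algebra R X]

/-- The inclusion of the constants as a homomorphism of `R`-algebras. -/
def laurentConst (R X : Type*) [CommRing R] [CommRing X] [Algebra R X] : X →ₐ[R] X[T;T⁻¹] :=
  IsScalarTower.toAlgHom R X X[T;T⁻¹]

/-- The inclusion `R[T, T⁻¹] → X[T, T⁻¹]`, which is the universal point of `𝔾ₘ` over `X`. -/
def laurentVar (R X : Type*) [CommRing R] [CommRing X] [Algebra R X] :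
    R[T;T⁻¹] →ₐ[R] X[T;T⁻¹] :=
  AddMonoidAlgebra.mapAlgHom ℤ (Algebra.ofId R X)

/-- Evaluation of Laurent polynomials at `T = 1`. -/
def laurentEvalOne (R X : Type*) [CommRing R] [CommRing X] [Algebra R X] : X[T;T⁻¹] →ₐ[R] X :=
  (AddMonoidAlgebra.lift X X ℤ 1).restrictScalars R

/-- The homomorphism `∑ aₙ Tⁿ ↦ ∑ (aₙ Tⁿ) Tⁿ`, which is the coaction given by the grading of
`X[T, T⁻¹]`. -/
def laurentDiag (R X : Type*) [CommRing R] [CommRing X] [Algebra R X] :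
    X[T;T⁻¹] →ₐ[R] X[T;T⁻¹][T;T⁻¹] :=
  (AddMonoidAlgebra.lift X X[T;T⁻¹][T;T⁻¹] ℤ
    { toFun n := .single n.toAdd (.single n.toAdd 1)
      map_one' := rfl
      map_mul' m n := by
        rw [AddMonoidAlgebra.single_mul_single, AddMonoidAlgebra.single_mul_single, mul_one,
          toAdd_mul] }).restrictScalars R

lemma laurentConst_apply (x : X) : laurentConst R X x = .single 0 x := rfl

lemma laurentEvalOne_single (n : ℤ) (x : X) : laurentEvalOne R X (.single n x) = x := by
  simp [laurentEvalOne, -LaurentPolynomial.single_eq_C_mul_T]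

lemma laurentDiag_single (n : ℤ) (x : X) :
    laurentDiag R X (.single n x) = .single n (.single n x) := by
  simp [laurentDiag, -LaurentPolynomial.single_eq_C_mul_T, AddMonoidAlgebra.smul_single]

lemma laurentEvalOne_eq_sum (p : X[T;T⁻¹]) :
    laurentEvalOne R X p = p.coeff.sum fun _ x => x := by
  simp [laurentEvalOne, AddMonoidAlgebra.lift_apply]

lemma coeff_laurentDiag (p : X[T;T⁻¹]) (n : ℤ) :
    (laurentDiag R X p).coeff n = .single n (p.coeff n) := by
  induction p using AddMonoidAlgebra.induction_linear with
  | zero => simp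
  | add p q hp hq => simp [hp, hq]
  | single m x =>
    rw [laurentDiag_single, AddMonoidAlgebra.coeff_single, AddMonoidAlgebra.coeff_single]
    by_cases h : m = n
    · simp [h]
    · simp [Finsupp.single_eq_of_ne' h]

end Laurent

section Coaction

variable {R C : Type*} [CommRing R] [CommRing C] [Algebra R C]

/-- The axioms for `ρ : C → C[T, T⁻¹]` to be a coaction, that is, an action of `𝔾ₘ` on
`Spec C`. -/
structure IsCoaction (ρ : C →ₐ[R] C[T;T⁻¹]) : Prop where
  counit : (laurentEvalOne R C).comp ρ = AlgHom.id R C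
  coassoc : (AddMonoidAlgebra.mapAlgHom ℤ ρ).comp ρ = (laurentDiag R C).comp ρ

/-- The elements of weight `n` for a coaction `ρ`. -/
def coactionWeight (ρ : C →ₐ[R] C[T;T⁻¹]) (n : ℤ) : Submodule R C where
  carrier := {c | ρ c = .single n c}
  add_mem' {a b} ha hb := by
    simp only [Set.mem_ofPred_eq] at *
    rw [map_add, ha, hb, AddMonoidAlgebra.single_add]
  zero_mem' := by simp
  smul_mem' r a ha := by
    simp only [Set.mem_ofPred_eq] at *
    rw [map_smul, ha, AddMonoidAlgebra.smul_single]

lemma mem_coactionWeight {ρ : C →ₐ[R] C[T;T⁻¹]} {n : ℤ} {c : C} :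
    c ∈ coactionWeight ρ n ↔ ρ c = .single n c :=
  Iff.rfl

instance coactionWeight_gradedMonoid (ρ : C →ₐ[R] C[T;T⁻¹]) :
    SetLike.GradedMonoid (coactionWeight ρ) where
  one_mem := map_one ρ
  mul_mem i j a b ha hb := by
    rw [mem_coactionWeight] at *
    rw [map_mul, ha, hb, AddMonoidAlgebra.single_mul_single]

variable {ρ : C →ₐ[R] C[T;T⁻¹]}

lemma IsCoaction.coeff_mem (hρ : IsCoaction ρ) (c : C) (n : ℤ) :
    (ρ c).coeff n ∈ coactionWeight ρ n := by
  have h := congrArg (fun p => p.coeff n) (DFunLike.congr_fun hρ.coassoc c)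
  rwa [AlgHom.comp_apply, AlgHom.comp_apply, AddMonoidAlgebra.coeff_mapAlgHom,
    coeff_laurentDiag] at h

lemma IsCoaction.sum_coeff (hρ : IsCoaction ρ) (c : C) : ((ρ c).coeff.sum fun _ x => x) = c := by
  rw [← laurentEvalOne_eq_sum (R := R)]
  exact DFunLike.congr_fun hρ.counit c

lemma coeff_coeAddMonoidHom (x : DirectSum ℤ fun n => coactionWeight ρ n) (n : ℤ) :
    (ρ (DirectSum.coeAddMonoidHom (coactionWeight ρ) x)).coeff n = x n := by
  induction x using DirectSum.induction_on with
  | zero => simp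
  | of i a =>
    rw [DirectSum.coeAddMonoidHom_of, mem_coactionWeight.mp a.2, AddMonoidAlgebra.coeff_single,
      DirectSum.coe_of_apply, Finsupp.single_apply]
    split_ifs <;> rfl
  | add x y hx hy => simp [hx, hy]

lemma coeAddMonoidHom_coactionWeight_injective :
    Function.Injective (DirectSum.coeAddMonoidHom (coactionWeight ρ)) := fun x y hxy => by
  ext n
  rw [← coeff_coeAddMonoidHom, hxy, coeff_coeAddMonoidHom]

/-- The grading of `C` defined by a coaction: the components of `c` are the coefficients of
`ρ c`. -/
abbrev IsCoaction.gradedAlgebra (hρ : IsCoaction ρ) : GradedAlgebra (coactionWeight ρ) :=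
  have h : Function.LeftInverse (DirectSum.coeAddMonoidHom (coactionWeight ρ)) fun c =>
      ∑ n ∈ (ρ c).coeff.support,
        DirectSum.of (fun n => coactionWeight ρ n) n ⟨_, hρ.coeff_mem c n⟩ := fun c => by
    simp only [map_sum, DirectSum.coeAddMonoidHom_of]
    exact hρ.sum_coeff c
  { decompose' := _
    left_inv := h
    right_inv := h.rightInverse_of_injective coeAddMonoidHom_coactionWeight_injective }

end Coaction

section GradedCoaction

variable {R S X : Type*} [CommRing R] [CommRing S] [Algebra R S] [CommRing X] [Algebra R X]
variable (𝒮 : ℤ → Submodule R S) [GradedAlgebra 𝒮]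

/-- The homomorphism given by `φ n` on the homogeneous elements of degree `n`. -/
def gradedLift (φ : ℤ → S →ₗ[R] X) (h_one : φ 0 1 = 1)
    (h_mul : ∀ m n, ∀ a ∈ 𝒮 m, ∀ b ∈ 𝒮 n, φ (m + n) (a * b) = φ m a * φ n b) : S →ₐ[R] X :=
  (DirectSum.toAlgebra R (fun n => 𝒮 n) (fun n => (φ n).comp (𝒮 n).subtype) h_one
    (fun a b => h_mul _ _ a a.2 b b.2)).comp (DirectSum.decomposeAlgEquiv 𝒮).toAlgHom

/-- The coaction `s ↦ ∑ sₙ Tⁿ` defined by a grading. -/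
def gradedCoaction : S →ₐ[R] S[T;T⁻¹] :=
  gradedLift 𝒮 AddMonoidAlgebra.lsingle rfl
    fun _ _ _ _ _ _ => (AddMonoidAlgebra.single_mul_single ..).symm

variable {𝒮}

lemma gradedLift_of_mem {φ : ℤ → S →ₗ[R] X} {h_one : φ 0 1 = 1}
    {h_mul : ∀ m n, ∀ a ∈ 𝒮 m, ∀ b ∈ 𝒮 n, φ (m + n) (a * b) = φ m a * φ n b}
    {n : ℤ} {s : S} (hs : s ∈ 𝒮 n) : gradedLift 𝒮 φ h_one h_mul s = φ n s := by
  have h : (DirectSum.decomposeAlgEquiv 𝒮).toAlgHom s = DirectSum.of (fun n => 𝒮 n) n ⟨s, hs⟩ :=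
    DirectSum.decompose_of_mem _ hs
  rw [gradedLift, AlgHom.comp_apply, h]
  exact DirectSum.toAddMonoid_of (fun n => ((φ n).comp (𝒮 n).subtype).toAddMonoidHom) n ⟨s, hs⟩

lemma gradedCoaction_of_mem {n : ℤ} {s : S} (hs : s ∈ 𝒮 n) :
    gradedCoaction 𝒮 s = .single n s :=
  gradedLift_of_mem hs

lemma coeff_gradedCoaction (s : S) (n : ℤ) :
    (gradedCoaction 𝒮 s).coeff n = DirectSum.decompose 𝒮 s n := by
  induction s using DirectSum.Decomposition.inductionOn 𝒮 with
  | zero => simp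
  | @homogeneous i a =>
    rw [gradedCoaction_of_mem a.2, AddMonoidAlgebra.coeff_single, DirectSum.decompose_coe,
      DirectSum.coe_of_apply, Finsupp.single_apply]
    split_ifs <;> rfl
  | add a b ha hb => simp [ha, hb]

lemma mem_iff_gradedCoaction_eq {n : ℤ} {s : S} :
    s ∈ 𝒮 n ↔ gradedCoaction 𝒮 s = .single n s := by
  refine ⟨gradedCoaction_of_mem, fun h => ?_⟩
  have hs := coeff_gradedCoaction (𝒮 := 𝒮) s n
  rw [h, AddMonoidAlgebra.coeff_single, Finsupp.single_eq_same] at hs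
  exact hs ▸ SetLike.coe_mem _

lemma algHom_ext_of_homogeneous {φ ψ : S →ₐ[R] X} (h : ∀ n, ∀ s ∈ 𝒮 n, φ s = ψ s) : φ = ψ := by
  ext s
  induction s using DirectSum.Decomposition.inductionOn 𝒮 with
  | zero => simp
  | homogeneous a => exact h _ a a.2
  | add a b ha hb => rw [map_add, map_add, ha, hb]

end GradedCoaction

/-! ### Conjugation by a cocharacter -/

section Points

lemma mul_inv_mul_mul_mul {G : Type*} [Group G] (a b c : G) :
    (a * b)⁻¹ * c * (a * b) = b⁻¹ * (a⁻¹ * c * a) * b := by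
  group

variable {W A X Y Z : Type*} [CommRing W] [CommRing A] [HopfAlgebra W A] [CommSemiring X]
  [Algebra W X] [CommSemiring Y] [Algebra W Y] [CommSemiring Z] [Algebra W Z]

/-- The homomorphism `G(X) → G(Y)` induced by `X → Y`, where `G = Spec A`. -/
def mapPoints (A : Type*) [CommRing A] [HopfAlgebra W A] (φ : X →ₐ[W] Y) :
    WithConv (A →ₐ[W] X) →* WithConv (A →ₐ[W] Y) where
  toFun g := toConv (φ.comp g.ofConv)
  map_one' := by
    ext a
    simp [AlgHom.convOne_def]
  map_mul' g h := by rw [AlgHom.comp_convMul_distrib]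

lemma mapPoints_apply (φ : X →ₐ[W] Y) (g : WithConv (A →ₐ[W] X)) (a : A) :
    (mapPoints A φ g).ofConv a = φ (g.ofConv a) :=
  rfl

lemma mapPoints_mapPoints (ψ : Y →ₐ[W] Z) (φ : X →ₐ[W] Y) (g : WithConv (A →ₐ[W] X)) :
    mapPoints A ψ (mapPoints A φ g) = mapPoints A (ψ.comp φ) g :=
  rfl

lemma mapPoints_toConv_id (φ : A →ₐ[W] X) : mapPoints A φ (toConv (AlgHom.id W A)) = toConv φ :=
  rfl

/-- The group structure on `G(X)`. Mathlib provides it only when `X` is a bialgebra. -/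
instance pointsGroup : Group (WithConv (A →ₐ[W] X)) where
  inv g := toConv (g.ofConv.comp (HopfAlgebra.antipodeAlgHom W A))
  inv_mul_cancel g := by
    have h := map_mul (mapPoints A g.ofConv) (toConv (HopfAlgebra.antipodeAlgHom W A))
      (toConv (AlgHom.id W A))
    rw [AlgHom.antipode_id_cancel, map_one] at h
    exact h.symm

end Points

section Twist

variable {W A X Y : Type*} [CommRing W] [CommRing A] [HopfAlgebra W A] [CommRing X]
  [Algebra W X] [CommRing Y] [Algebra W Y] (μ : A →ₐc[W] W[T;T⁻¹])

/-- The point `μ(T)` of `G` over `X[T, T⁻¹]`. -/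
def cocharPoint (X : Type*) [CommRing X] [Algebra W X] : WithConv (A →ₐ[W] X[T;T⁻¹]) :=
  toConv ((laurentVar W X).comp (μ : A →ₐ[W] W[T;T⁻¹]))

/-- The homomorphism `g ↦ μ(T)⁻¹ g μ(T)` from `G(X)` to `G(X[T, T⁻¹])`. -/
def twist (X : Type*) [CommRing X] [Algebra W X] :
    WithConv (A →ₐ[W] X) →* WithConv (A →ₐ[W] X[T;T⁻¹]) :=
  (MulAut.conj (cocharPoint μ X)⁻¹).toMonoidHom.comp (mapPoints A (laurentConst W X))

lemma twist_eq (g : WithConv (A →ₐ[W] X)) :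
    twist μ X g = (cocharPoint μ X)⁻¹ * mapPoints A (laurentConst W X) g * cocharPoint μ X := by
  simp [twist]

lemma mapPoints_cocharPoint (φ : X →ₐ[W] Y) :
    mapPoints A (AddMonoidAlgebra.mapAlgHom ℤ φ) (cocharPoint μ X) = cocharPoint μ Y := by
  have h : (AddMonoidAlgebra.mapAlgHom ℤ φ).comp (laurentVar W X) = laurentVar W Y :=
    AddMonoidAlgebra.algHom_ext (fun n => by
      simp [laurentVar, -LaurentPolynomial.single_eq_C_mul_T]) (Subsingleton.elim _ _)
  rw [cocharPoint, cocharPoint, ← h]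
  rfl

lemma mapPoints_twist (φ : X →ₐ[W] Y) (g : WithConv (A →ₐ[W] X)) :
    mapPoints A (AddMonoidAlgebra.mapAlgHom ℤ φ) (twist μ X g) = twist μ Y (mapPoints A φ g) := by
  have hφ : (AddMonoidAlgebra.mapAlgHom ℤ φ).comp (laurentConst W X) =
      (laurentConst W Y).comp φ := by
    ext x
    simp [laurentConst_apply, -LaurentPolynomial.single_eq_C_mul_T]
  simp only [twist_eq, map_mul, map_inv, mapPoints_cocharPoint, mapPoints_mapPoints, hφ]

lemma mapPoints_laurentEvalOne_cocharPoint :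
    mapPoints A (laurentEvalOne W X) (cocharPoint μ X) = 1 := by
  have h : (laurentEvalOne W X).comp (laurentVar W X) =
      (Algebra.ofId W X).comp (Bialgebra.counitAlgHom W W[T;T⁻¹]) :=
    AddMonoidAlgebra.algHom_ext (fun n => by
      simp [laurentVar, laurentEvalOne_single, -LaurentPolynomial.single_eq_C_mul_T])
      (Subsingleton.elim _ _)
  ext a
  change ((laurentEvalOne W X).comp (laurentVar W X)) (μ a) = _
  rw [h]
  simp [AlgHom.convOne_def]

lemma mapPoints_laurentEvalOne_twist (g : WithConv (A →ₐ[W] X)) :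
    mapPoints A (laurentEvalOne W X) (twist μ X g) = g := by
  have h : (laurentEvalOne W X).comp (laurentConst W X) = AlgHom.id W X := by
    ext x
    simp [laurentConst_apply, laurentEvalOne_single, -LaurentPolynomial.single_eq_C_mul_T]
  simp only [twist_eq, map_mul, map_inv, mapPoints_laurentEvalOne_cocharPoint, mapPoints_mapPoints,
    h, inv_one, one_mul, mul_one]
  rfl

lemma mapPoints_laurentDiag_cocharPoint :
    mapPoints A (laurentDiag W X) (cocharPoint μ X) =
      mapPoints A (laurentConst W X[T;T⁻¹]) (cocharPoint μ X) * cocharPoint μ X[T;T⁻¹] := by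
  have h : (laurentDiag W X).comp (laurentVar W X) =
      (toConv ((laurentConst W X[T;T⁻¹]).comp (laurentVar W X)) *
        toConv (laurentVar W X[T;T⁻¹])).ofConv :=
    AddMonoidAlgebra.algHom_ext (fun n => by
      change _ = (toConv ((laurentConst W X[T;T⁻¹]).comp (laurentVar W X)) *
        toConv (laurentVar W X[T;T⁻¹])) (LaurentPolynomial.T n)
      rw [AlgHom.convMul_apply, LaurentPolynomial.comul_T]
      simp [laurentVar, laurentConst_apply, laurentDiag_single, LaurentPolynomial.T,
        AddMonoidAlgebra.single_mul_single, -LaurentPolynomial.single_eq_C_mul_T])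
      (Subsingleton.elim _ _)
  apply WithConv.ofConv_injective
  change ((laurentDiag W X).comp (laurentVar W X)).comp (μ : A →ₐ[W] W[T;T⁻¹]) = _
  rw [h, AlgHom.convMul_comp_bialgHom_distrib]
  rfl

lemma mapPoints_laurentDiag_twist (g : WithConv (A →ₐ[W] X)) :
    mapPoints A (laurentDiag W X) (twist μ X g) = twist μ X[T;T⁻¹] (twist μ X g) := by
  have h : (laurentDiag W X).comp (laurentConst W X) =
      (laurentConst W X[T;T⁻¹]).comp (laurentConst W X) := by
    ext x
    simp only [AlgHom.comp_apply, laurentConst_apply, laurentDiag_single]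
  rw [twist_eq, twist_eq]
  simp only [map_mul, map_inv, mapPoints_laurentDiag_cocharPoint, mapPoints_mapPoints, h]
  exact mul_inv_mul_mul_mul (G := WithConv (A →ₐ[W] X[T;T⁻¹][T;T⁻¹])) _ _ _

/-- The coaction `A → A[T, T⁻¹]` of the conjugation action of `𝔾ₘ` on `G`. -/
def twistCoaction : A →ₐ[W] A[T;T⁻¹] :=
  (twist μ A (toConv (AlgHom.id W A))).ofConv

lemma twist_eq_mapPoints (g : WithConv (A →ₐ[W] X)) :
    twist μ X g = toConv ((AddMonoidAlgebra.mapAlgHom ℤ g.ofConv).comp (twistCoaction μ)) :=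
  (mapPoints_twist μ g.ofConv (toConv (AlgHom.id W A))).symm

lemma isCoaction_twistCoaction : IsCoaction (twistCoaction μ) where
  counit := congrArg WithConv.ofConv (mapPoints_laurentEvalOne_twist μ (toConv (AlgHom.id W A)))
  coassoc := by
    have h := mapPoints_laurentDiag_twist μ (toConv (AlgHom.id W A))
    rw [twist_eq_mapPoints μ (twist μ A _)] at h
    exact congrArg WithConv.ofConv h.symm

end Twist

section WeightSpace

variable {W A X : Type*} [CommRing W] [CommRing A] [HopfAlgebra W A] [CommRing X] [Algebra W X]
variable (μ : A →ₐc[W] W[T;T⁻¹])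

lemma scalarTensorEquiv_conjCoaction (f : A) :
    AddMonoidAlgebra.scalarTensorEquiv W A (conjCoaction μ f) = twistCoaction μ f := by
  let e : A ⊗[W] W[T;T⁻¹] →ₐ[W] A[T;T⁻¹] :=
    ((AddMonoidAlgebra.scalarTensorEquiv W A :
      A ⊗[W] W[T;T⁻¹] ≃ₐ[A] A[T;T⁻¹]) : A ⊗[W] W[T;T⁻¹] →ₐ[A] A[T;T⁻¹]).restrictScalars W
  have hconst : e.comp Algebra.TensorProduct.includeLeft = laurentConst W A := by
    ext a
    simp [e, laurentConst_apply, AddMonoidAlgebra.one_def, -LaurentPolynomial.single_eq_C_mul_T]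
  have hvar : e.comp Algebra.TensorProduct.includeRight = laurentVar W A :=
    AddMonoidAlgebra.algHom_ext (fun n => by
      simp [e, laurentVar, -LaurentPolynomial.single_eq_C_mul_T]) (Subsingleton.elim _ _)
  have hμ : e.comp (Algebra.TensorProduct.includeRight.comp (μ : A →ₐ[W] W[T;T⁻¹])) =
      (cocharPoint μ A).ofConv := by
    rw [← AlgHom.comp_assoc, hvar]
    rfl
  have h : mapPoints A e (toConv (conjCoaction μ)) = twist μ A (toConv (AlgHom.id W A)) := by
    rw [twist_eq, mapPoints_toConv_id, ← hconst]
    unfold conjCoaction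
    simp only [WithConv.toConv_ofConv]
    rw [map_mul, map_mul]
    congr 1
    · congr 1
      exact congrArg (fun m => toConv (m.comp (HopfAlgebra.antipodeAlgHom W A))) hμ
    · exact congrArg toConv hμ
  exact DFunLike.congr_fun (congrArg WithConv.ofConv h) f

lemma weightSpace_eq_coactionWeight : weightSpace μ = coactionWeight (twistCoaction μ) := by
  ext n f
  have h : AddMonoidAlgebra.scalarTensorEquiv W A (f ⊗ₜ[W] LaurentPolynomial.T n) =
      .single n f := by
    simp [LaurentPolynomial.T, -LaurentPolynomial.single_eq_C_mul_T]
  rw [mem_coactionWeight, ← scalarTensorEquiv_conjCoaction, ← h, EmbeddingLike.apply_eq_iff_eq]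
  rfl

instance weightSpace_gradedAlgebra : GradedAlgebra (weightSpace μ) :=
  weightSpace_eq_coactionWeight μ ▸ (isCoaction_twistCoaction μ).gradedAlgebra

variable {μ}

lemma twist_apply_of_mem (g : WithConv (A →ₐ[W] X)) {n : ℤ} {f : A} (hf : f ∈ weightSpace μ n) :
    (twist μ X g).ofConv f = .single n (g.ofConv f) := by
  rw [weightSpace_eq_coactionWeight, mem_coactionWeight] at hf
  rw [twist_eq_mapPoints]
  simp [hf, -LaurentPolynomial.single_eq_C_mul_T]

lemma coeff_twist (g : WithConv (A →ₐ[W] X)) (f : A) (n : ℤ) :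
    ((twist μ X g).ofConv f).coeff n = g.ofConv (DirectSum.decompose (weightSpace μ) f n) := by
  have h : (twist μ X g).ofConv =
      (AddMonoidAlgebra.mapAlgHom ℤ g.ofConv).comp (gradedCoaction (weightSpace μ)) :=
    algHom_ext_of_homogeneous (𝒮 := weightSpace μ) fun n f hf => by
      rw [twist_apply_of_mem g hf, AlgHom.comp_apply, gradedCoaction_of_mem hf]
      simp [-LaurentPolynomial.single_eq_C_mul_T]
  rw [h, AlgHom.comp_apply, AddMonoidAlgebra.coeff_mapAlgHom, coeff_gradedCoaction]

lemma counit_eq_zero_of_mem {n : ℤ} (hn : n ≠ 0) {f : A} (hf : f ∈ weightSpace μ n) :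
    Coalgebra.counit (R := W) f = 0 := by
  have h := congrArg (fun p => p.coeff n) (twist_apply_of_mem (1 : WithConv (A →ₐ[W] W)) hf)
  have h0 : (1 : WithConv (A →ₐ[W] W[T;T⁻¹])).ofConv f = .single 0 (Coalgebra.counit (R := W) f) :=
    rfl
  rw [map_one, h0, AddMonoidAlgebra.coeff_single, AddMonoidAlgebra.coeff_single,
    Finsupp.single_eq_same, Finsupp.single_eq_of_ne' hn.symm] at h
  exact h.symm

end WeightSpace

/-! ### The subgroups `P⁻` and `U⁺` -/

section Subgroups

variable {W A X Y : Type*} [CommRing W] [CommRing A] [HopfAlgebra W A] [CommRing X] [Algebra W X]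
  [CommRing Y] [Algebra W Y] (μ : A →ₐc[W] W[T;T⁻¹])

lemma coeff_mul_mem {M : Type*} [SetLike M X] [AddSubmonoidClass M X] {p q : X[T;T⁻¹]} {n : ℤ}
    {N : M} (h : ∀ i j, i + j = n → p.coeff i * q.coeff j ∈ N) : (p * q).coeff n ∈ N := by
  rw [AddMonoidAlgebra.coeff_mul]
  refine sum_mem fun i _ => sum_mem fun j _ => ?_
  dsimp only
  split_ifs with hij
  · exact h i j hij
  · exact zero_mem _

/-- The Laurent polynomials whose `n`-th coefficient lies in `Q n` for all `n`. -/
def coneSubalgebra (Q : ℤ → Submodule W X) [SetLike.GradedMonoid Q] : Subalgebra W X[T;T⁻¹] where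
  carrier := {p | ∀ n, p.coeff n ∈ Q n}
  mul_mem' hp hq n := coeff_mul_mem fun i j hij =>
    hij ▸ SetLike.GradedMul.mul_mem (hp i) (hq j)
  add_mem' hp hq n := add_mem (hp n) (hq n)
  algebraMap_mem' r n := by
    rw [LaurentPolynomial.algebraMap_apply, LaurentPolynomial.C_apply]
    split_ifs with h
    · rw [h, Algebra.algebraMap_eq_smul_one]
      exact Submodule.smul_mem _ _ SetLike.GradedOne.one_mem
    · exact zero_mem _

lemma mem_range_mapPoints_val {B : Subalgebra W X} {g : WithConv (A →ₐ[W] X)} :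
    g ∈ (mapPoints A B.val).range ↔ ∀ f, g.ofConv f ∈ B := by
  constructor
  · rintro ⟨h, rfl⟩ f
    exact (h.ofConv f).2
  · exact fun h => ⟨toConv (g.ofConv.codRestrict B h), rfl⟩

/-- The display group as a subgroup of `G(X)`, for a family `Q` which need not be a grading. -/
def displaySubgroup (Q : ℤ → Submodule W X) [SetLike.GradedMonoid Q] :
    Subgroup (WithConv (A →ₐ[W] X)) :=
  (mapPoints A (coneSubalgebra Q).val).range.comap (twist μ X)

variable {μ}

lemma mem_displaySubgroup {Q : ℤ → Submodule W X} [SetLike.GradedMonoid Q]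
    {g : WithConv (A →ₐ[W] X)} : g ∈ displaySubgroup μ Q ↔ g ∈ displayGroup μ Q := by
  rw [displaySubgroup, Subgroup.mem_comap, mem_range_mapPoints_val]
  refine ⟨fun h n f hf => ?_, fun h f n => ?_⟩
  · have := h f n
    rwa [coeff_twist, DirectSum.decompose_of_mem_same _ hf] at this
  · rw [coeff_twist]
    exact h n _ (SetLike.coe_mem _)

variable (W X)

/-- The homogeneity condition that defines `P⁻`. -/
def minusCone (n : ℤ) : Submodule W X where
  carrier := {x | 0 < n → x = 0}
  add_mem' hx hy hn := by rw [hx hn, hy hn, add_zero]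
  zero_mem' _ := rfl
  smul_mem' w x hx hn := by rw [hx hn, smul_zero]

instance : SetLike.GradedMonoid (minusCone W X) where
  one_mem h := absurd h (lt_irrefl 0)
  mul_mem m n x y hx hy hmn := by
    rcases lt_or_ge 0 m with hm | hm
    · rw [hx hm, zero_mul]
    · rw [hy (by lia), mul_zero]

/-- The homogeneity condition that defines `U⁺`, imposed on the pair `(1, g)`: the first component
makes it possible to express that `g` agrees with the unit section on functions of degree zero. -/
def plusCone (n : ℤ) : Submodule W (W × X) where
  carrier := {x | (n ≠ 0 → x.1 = 0) ∧ (n ≤ 0 → x.2 = algebraMap W X x.1)}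
  add_mem' hx hy := ⟨fun hn => by simp [hx.1 hn, hy.1 hn], fun hn => by simp [hx.2 hn, hy.2 hn]⟩
  zero_mem' := by simp
  smul_mem' w x hx := ⟨fun hn => by simp [hx.1 hn],
    fun hn => by simp [hx.2 hn, Algebra.smul_def]⟩

variable {W X}

lemma eq_zero_of_mem_plusCone {n : ℤ} (hn : n < 0) {x : W × X} (hx : x ∈ plusCone W X n) :
    x = 0 := by
  have h := hx.1 hn.ne
  exact Prod.ext h (by rw [hx.2 hn.le, h, map_zero, Prod.snd_zero])

instance : SetLike.GradedMonoid (plusCone W X) where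
  one_mem := ⟨fun h => absurd rfl h, fun _ => by simp⟩
  mul_mem m n x y hx hy := by
    rcases lt_or_ge m 0 with hm | hm
    · rw [eq_zero_of_mem_plusCone hm hx, zero_mul]
      exact zero_mem _
    rcases lt_or_ge n 0 with hn | hn
    · rw [eq_zero_of_mem_plusCone hn hy, mul_zero]
      exact zero_mem _
    refine ⟨fun hmn => ?_, fun hmn => ?_⟩
    · rcases ne_or_eq m 0 with hm' | rfl
      · rw [Prod.fst_mul, hx.1 hm', zero_mul]
      · rw [Prod.fst_mul, hy.1 (by lia), mul_zero]
    · rw [Prod.snd_mul, hx.2 (by lia), hy.2 (by lia), Prod.fst_mul, map_mul]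

variable (W A X) in
/-- The homomorphism `g ↦ (1, g)` from `G(X)` to `G(W × X)`. -/
def augment : WithConv (A →ₐ[W] X) →* WithConv (A →ₐ[W] W × X) where
  toFun g := toConv ((Bialgebra.counitAlgHom W A).prod g.ofConv)
  map_one' := rfl
  map_mul' g h := by
    let aug (g : WithConv (A →ₐ[W] X)) : WithConv (A →ₐ[W] W × X) :=
      toConv ((Bialgebra.counitAlgHom W A).prod g.ofConv)
    have hfst : mapPoints A (AlgHom.fst W W X) (aug g * aug h) = 1 :=
      (map_mul _ _ _).trans (one_mul 1)
    have hsnd : mapPoints A (AlgHom.snd W W X) (aug g * aug h) = g * h := map_mul _ _ _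
    ext a
    · exact (DFunLike.congr_fun (congrArg WithConv.ofConv hfst) a).symm
    · exact (DFunLike.congr_fun (congrArg WithConv.ofConv hsnd) a).symm

lemma augment_apply (g : WithConv (A →ₐ[W] X)) (f : A) :
    (augment W A X g).ofConv f = (Coalgebra.counit (R := W) f, g.ofConv f) :=
  rfl

/-- The group `P⁻(X)`. -/
def minusSubgroup (μ : A →ₐc[W] W[T;T⁻¹]) (X : Type*) [CommRing X] [Algebra W X] :
    Subgroup (WithConv (A →ₐ[W] X)) :=
  displaySubgroup μ (minusCone W X)

/-- The group `U⁺(X)`. -/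
def unipSubgroup (μ : A →ₐc[W] W[T;T⁻¹]) (X : Type*) [CommRing X] [Algebra W X] :
    Subgroup (WithConv (A →ₐ[W] X)) :=
  (displaySubgroup μ (plusCone W X)).comap (augment W A X)

lemma mem_minusSubgroup {g : WithConv (A →ₐ[W] X)} :
    g ∈ minusSubgroup μ X ↔ ∀ n > 0, ∀ f ∈ weightSpace μ n, g.ofConv f = 0 :=
  mem_displaySubgroup.trans
    ⟨fun h n hn f hf => h n f hf hn, fun h n f hf hn => h n hn f hf⟩

lemma mem_unipSubgroup {g : WithConv (A →ₐ[W] X)} :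
    g ∈ unipSubgroup μ X ↔ ∀ n ≤ 0, ∀ f ∈ weightSpace μ n,
      g.ofConv f = algebraMap W X (Coalgebra.counit (R := W) f) :=
  mem_displaySubgroup.trans
    ⟨fun h n hn f hf => (h n f hf).2 hn,
      fun h n f hf => ⟨fun hn => counit_eq_zero_of_mem hn hf, fun hn => h n hn f hf⟩⟩

lemma mem_minusSubgroup_iff_idealPMinus {g : WithConv (A →ₐ[W] X)} :
    g ∈ minusSubgroup μ X ↔ ∀ f ∈ idealPMinus μ, g.ofConv f = 0 := by
  change _ ↔ idealPMinus μ ≤ RingHom.ker g.ofConv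
  rw [mem_minusSubgroup, idealPMinus, Ideal.span_le]
  exact ⟨fun h f ⟨n, hn, hf⟩ => h n hn f hf, fun h n hn f hf => h ⟨n, hn, hf⟩⟩

lemma mem_unipSubgroup_iff_idealUPlus {g : WithConv (A →ₐ[W] X)} :
    g ∈ unipSubgroup μ X ↔ ∀ f ∈ idealUPlus μ, g.ofConv f = 0 := by
  change _ ↔ idealUPlus μ ≤ RingHom.ker g.ofConv
  rw [mem_unipSubgroup, idealUPlus, sup_le_iff, idealPPlus, Ideal.span_le, Ideal.span_le]
  refine ⟨fun h => ⟨?_, ?_⟩, fun ⟨hneg, hzero⟩ n hn f hf => ?_⟩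
  · rintro f ⟨n, hn, hf⟩
    have hgf := h n hn.le f hf
    rwa [counit_eq_zero_of_mem hn.ne hf, map_zero] at hgf
  · rintro _ ⟨a, ha, rfl⟩
    simp [RingHom.mem_ker, h 0 le_rfl a ha]
  · rcases hn.lt_or_eq with hn | rfl
    · rw [counit_eq_zero_of_mem hn.ne hf, map_zero]
      exact hneg ⟨n, hn, hf⟩
    · have hgf : g.ofConv (f - algebraMap W A (Coalgebra.counit (R := W) f)) = 0 :=
        hzero ⟨f, hf, rfl⟩
      rwa [map_sub, sub_eq_zero, AlgHom.commutes] at hgf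

lemma mapPoints_mem_minusSubgroup {g : WithConv (A →ₐ[W] X)} (hg : g ∈ minusSubgroup μ X)
    (φ : X →ₐ[W] Y) : mapPoints A φ g ∈ minusSubgroup μ Y :=
  mem_minusSubgroup.mpr fun n hn f hf => by
    rw [mapPoints_apply, mem_minusSubgroup.mp hg n hn f hf, map_zero]

lemma mapPoints_mem_unipSubgroup {g : WithConv (A →ₐ[W] X)} (hg : g ∈ unipSubgroup μ X)
    (φ : X →ₐ[W] Y) : mapPoints A φ g ∈ unipSubgroup μ Y :=
  mem_unipSubgroup.mpr fun n hn f hf => by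
    rw [mapPoints_apply, mem_unipSubgroup.mp hg n hn f hf, AlgHom.commutes]

lemma disjoint_minusSubgroup_unipSubgroup :
    Disjoint (minusSubgroup μ X) (unipSubgroup μ X) := by
  rw [Subgroup.disjoint_def]
  intro g hg hg'
  apply WithConv.ofConv_injective
  refine algHom_ext_of_homogeneous (𝒮 := weightSpace μ) fun n f hf => ?_
  rcases le_or_gt n 0 with hn | hn
  · exact mem_unipSubgroup.mp hg' n hn f hf
  · rw [mem_minusSubgroup.mp hg n hn f hf,
      mem_minusSubgroup.mp (one_mem (minusSubgroup μ X)) n hn f hf]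

lemma eq_and_eq_of_mul_eq_mul {q q' h h' : WithConv (A →ₐ[W] X)} (hq : q ∈ minusSubgroup μ X)
    (hq' : q' ∈ minusSubgroup μ X) (hh : h ∈ unipSubgroup μ X) (hh' : h' ∈ unipSubgroup μ X)
    (e : q * h = q' * h') : q = q' ∧ h = h' := by
  have hpair := Subgroup.mul_injective_of_disjoint disjoint_minusSubgroup_unipSubgroup
    (a₁ := (⟨q, hq⟩, ⟨h, hh⟩)) (a₂ := (⟨q', hq'⟩, ⟨h', hh'⟩)) e
  simpa using hpair

end Subgroups

/-! ### Square-zero extensions -/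

section SquareZero

variable {W A X Y : Type*} [CommRing W] [CommRing A] [CommRing X] [Algebra W X]
  [CommRing Y] [Algebra W Y]

/-- The kernel of `φ` has square zero. -/
def SqZeroKer (φ : X →ₐ[W] Y) : Prop :=
  ∀ x y, φ x = 0 → φ y = 0 → x * y = 0

lemma SqZeroKer.exists_lift [Algebra W A] [Algebra.FormallySmooth W A] {π : X →ₐ[W] Y}
    (hπ : SqZeroKer π) (g : A →ₐ[W] Y) (hg : ∀ f, g f ∈ π.range) :
    ∃ h : A →ₐ[W] X, π.comp h = g := by
  have hnil : IsNilpotent (RingHom.ker (π.rangeRestrict : X →+* π.range)) := by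
    refine ⟨2, ?_⟩
    rw [pow_two, Ideal.zero_eq_bot, ← le_bot_iff, Ideal.mul_le]
    exact fun x hx y hy => hπ x y (congrArg Subtype.val hx) (congrArg Subtype.val hy)
  refine ⟨Algebra.FormallySmooth.liftOfSurjective (g.codRestrict _ hg) π.rangeRestrict
    π.rangeRestrict_surjective hnil, ?_⟩
  ext f
  exact congrArg Subtype.val (Algebra.FormallySmooth.liftOfSurjective_apply _ π.rangeRestrict
    π.rangeRestrict_surjective hnil f)

lemma coeff_mul_add_eq {p q : X[T;T⁻¹]} {m n : ℤ}
    (h : ∀ i j, i ≠ m → j ≠ n → p.coeff i * q.coeff j = 0) :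
    (p * q).coeff (m + n) = p.coeff m * q.coeff n := by
  rw [AddMonoidAlgebra.coeff_mul, Finsupp.sum, Finset.sum_eq_single m]
  · rw [Finsupp.sum, Finset.sum_eq_single n, if_pos rfl]
    · exact fun j _ hj => if_neg fun hij => hj (add_left_cancel hij)
    · exact fun hn => by rw [Finsupp.notMem_support_iff.mp hn, mul_zero, ite_self]
  · refine fun i _ hi => Finset.sum_eq_zero fun j _ => ?_
    exact ite_eq_right_iff.mpr fun hij => h i j hi fun hj => hi (add_right_cancel (hj ▸ hij))
  · exact fun hm => by simp [Finsupp.notMem_support_iff.mp hm]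

lemma exists_algHom_eq_coeff [Algebra W A] {𝒜 : ℤ → Submodule W A} [GradedAlgebra 𝒜]
    (φ : A →ₐ[W] X[T;T⁻¹]) (h : ∀ m n, ∀ a ∈ 𝒜 m, ∀ b ∈ 𝒜 n, ∀ i j, i ≠ m → j ≠ n →
      (φ a).coeff i * (φ b).coeff j = 0) :
    ∃ ψ : A →ₐ[W] X, ∀ n, ∀ a ∈ 𝒜 n, ψ a = (φ a).coeff n := by
  let φn (n : ℤ) : A →ₗ[W] X :=
    { toFun a := (φ a).coeff n
      map_add' a b := by rw [map_add]; rfl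
      map_smul' r a := by rw [map_smul]; rfl }
  have h_one : φn 0 1 = 1 := by
    change (φ 1).coeff 0 = 1
    rw [map_one, AddMonoidAlgebra.coeff_one_zero]
  have h_mul (m n) (a) (ha : a ∈ 𝒜 m) (b) (hb : b ∈ 𝒜 n) :
      φn (m + n) (a * b) = φn m a * φn n b := by
    change (φ (a * b)).coeff (m + n) = _
    rw [map_mul]
    exact coeff_mul_add_eq (h m n a ha b hb)
  exact ⟨gradedLift 𝒜 φn h_one h_mul, fun n a ha => gradedLift_of_mem ha⟩

/-- The reduction of the coefficients along `π`. -/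
def coneMap (Q : ℤ → Submodule W X) [SetLike.GradedMonoid Q] (π : X →ₐ[W] Y) :
    coneSubalgebra Q →ₐ[W] Y[T;T⁻¹] :=
  (AddMonoidAlgebra.mapAlgHom ℤ π).comp (coneSubalgebra Q).val

variable {Q : ℤ → Submodule W X} [SetLike.GradedMonoid Q] {π : X →ₐ[W] Y}

lemma coeff_coneMap (p : coneSubalgebra Q) (n : ℤ) :
    (coneMap Q π p).coeff n = π (p.1.coeff n) :=
  AddMonoidAlgebra.coeff_mapAlgHom ..

lemma sqZeroKer_coneMap (hπ : SqZeroKer π) : SqZeroKer (coneMap Q π) := fun p q hp hq => by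
  have hker {p n} (hp : coneMap Q π p = 0) : π (p.1.coeff n) = 0 := by
    rw [← coeff_coneMap, hp]
    rfl
  ext n
  exact coeff_mul_mem (N := (⊥ : Ideal X)) fun i j _ => hπ _ _ (hker hp) (hker hq)

variable [HopfAlgebra W A] {μ : A →ₐc[W] W[T;T⁻¹]}

lemma twist_mem_range_coneMap {g : WithConv (A →ₐ[W] Y)}
    (hg : ∀ n, ∀ f ∈ weightSpace μ n, ∃ x ∈ Q n, π x = g.ofConv f) (f : A) :
    (twist μ Y g).ofConv f ∈ (coneMap Q π).range := by
  induction f using DirectSum.Decomposition.inductionOn (weightSpace μ) with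
  | zero => exact map_zero (twist μ Y g).ofConv ▸ zero_mem _
  | @homogeneous n f =>
    obtain ⟨x, hx, hxf⟩ := hg n f f.2
    refine ⟨⟨.single n x, fun m => ?_⟩, ?_⟩
    · rw [AddMonoidAlgebra.coeff_single, Finsupp.single_apply]
      split_ifs with h
      · exact h ▸ hx
      · exact zero_mem _
    · rw [twist_apply_of_mem g f.2, ← hxf]
      exact AddMonoidAlgebra.mapAlgHom_single ..
  | add a b ha hb => exact map_add (twist μ Y g).ofConv a b ▸ add_mem ha hb

lemma SqZeroKer.exists_lift_mem_displayGroup [Algebra.FormallySmooth W A] (hπ : SqZeroKer π)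
    {g : WithConv (A →ₐ[W] Y)}
    (hg : ∀ n, ∀ f ∈ weightSpace μ n, ∃ x ∈ Q n, π x = g.ofConv f) :
    ∃ h ∈ displayGroup μ Q, mapPoints A π h = g := by
  obtain ⟨φ, hφ⟩ := (sqZeroKer_coneMap hπ).exists_lift _ (twist_mem_range_coneMap hg)
  have hcoeff (f n) : π ((φ f).1.coeff n) = ((twist μ Y g).ofConv f).coeff n := by
    rw [← coeff_coneMap, ← hφ]
    rfl
  have hker {m i} {a : A} (ha : a ∈ weightSpace μ m) (hi : i ≠ m) :
      π ((φ a).1.coeff i) = 0 := by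
    rw [hcoeff, twist_apply_of_mem g ha]
    exact Finsupp.single_eq_of_ne hi
  obtain ⟨ψ, hψ⟩ := exists_algHom_eq_coeff (𝒜 := weightSpace μ) ((coneSubalgebra Q).val.comp φ)
    fun m n a ha b hb i j hi hj => hπ _ _ (hker ha hi) (hker hb hj)
  refine ⟨toConv ψ, fun n f hf => hψ n f hf ▸ (φ f).2 n, WithConv.ofConv_injective ?_⟩
  refine algHom_ext_of_homogeneous (𝒮 := weightSpace μ) fun n f hf => ?_
  rw [mapPoints_apply, hψ n f hf]
  exact (hcoeff f n).trans (by rw [coeff_twist, DirectSum.decompose_of_mem_same _ hf])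

variable [Algebra.FormallySmooth W A]

lemma exists_lift_mem_minusSubgroup (hπ : SqZeroKer π) (hsurj : Function.Surjective π)
    {g : WithConv (A →ₐ[W] Y)} (hg : g ∈ minusSubgroup μ Y) :
    ∃ h ∈ minusSubgroup μ X, mapPoints A π h = g := by
  have hlift (n : ℤ) (f) (hf : f ∈ weightSpace μ n) :
      ∃ x ∈ minusCone W X n, π x = g.ofConv f := by
    rcases le_or_gt n 0 with hn | hn
    · obtain ⟨x, hx⟩ := hsurj (g.ofConv f)
      exact ⟨x, fun h => absurd hn h.not_ge, hx⟩
    · exact ⟨0, zero_mem _, by rw [map_zero, mem_minusSubgroup.mp hg n hn f hf]⟩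
  obtain ⟨h, hh, rfl⟩ := hπ.exists_lift_mem_displayGroup hlift
  exact ⟨h, mem_displaySubgroup.mpr hh, rfl⟩

lemma exists_lift_mem_unipSubgroup (hπ : SqZeroKer π) (hsurj : Function.Surjective π)
    {g : WithConv (A →ₐ[W] Y)} (hg : g ∈ unipSubgroup μ Y) :
    ∃ h ∈ unipSubgroup μ X, mapPoints A π h = g := by
  let π₁ : W × X →ₐ[W] W × Y := (AlgHom.fst W W X).prod (π.comp (AlgHom.snd W W X))
  have hπ₁ : SqZeroKer π₁ := fun x y hx hy => by
    obtain ⟨hx₁, hx₂⟩ := Prod.mk_eq_zero.mp hx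
    obtain ⟨-, hy₂⟩ := Prod.mk_eq_zero.mp hy
    refine Prod.ext ?_ (hπ _ _ hx₂ hy₂)
    rw [Prod.fst_mul, show x.1 = 0 from hx₁, zero_mul, Prod.fst_zero]
  have hlift (n : ℤ) (f) (hf : f ∈ weightSpace μ n) :
      ∃ x ∈ plusCone W X n, π₁ x = (augment W A Y g).ofConv f := by
    rcases le_or_gt n 0 with hn | hn
    · refine ⟨algebraMap W (W × X) (Coalgebra.counit (R := W) f),
        ⟨fun hn' => counit_eq_zero_of_mem hn' hf, fun _ => rfl⟩, ?_⟩
      rw [AlgHom.commutes, augment_apply, mem_unipSubgroup.mp hg n hn f hf]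
      rfl
    · obtain ⟨x, hx⟩ := hsurj (g.ofConv f)
      refine ⟨(0, x), ⟨fun _ => rfl, fun h => absurd hn h.not_gt⟩, ?_⟩
      rw [augment_apply, counit_eq_zero_of_mem hn.ne' hf, ← hx]
      rfl
  obtain ⟨h, hh, e⟩ := hπ₁.exists_lift_mem_displayGroup hlift
  have hval (f) : π₁ (h.ofConv f) = (augment W A Y g).ofConv f := by rw [← e, mapPoints_apply]
  have haug : augment W A X (mapPoints A (AlgHom.snd W W X) h) = h := by
    ext f
    · exact (congrArg Prod.fst (hval f)).symm
    · rfl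
  refine ⟨mapPoints A (AlgHom.snd W W X) h, ?_, ?_⟩
  · rw [unipSubgroup, Subgroup.mem_comap, haug, mem_displaySubgroup]
    exact hh
  · ext f
    exact congrArg Prod.snd (hval f)

end SquareZero

section Infinitesimal

variable {W A X Y : Type*} [CommRing W] [CommRing A] [HopfAlgebra W A] [CommRing X]
  [Algebra W X] [CommRing Y] [Algebra W Y] {μ : A →ₐc[W] W[T;T⁻¹]} {π : X →ₐ[W] Y}

lemma map_sub_counit_eq_zero {g : WithConv (A →ₐ[W] X)} (hg : mapPoints A π g = 1) (f : A) :
    π (g.ofConv f - algebraMap W X (Coalgebra.counit (R := W) f)) = 0 := by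
  rw [map_sub, AlgHom.commutes, sub_eq_zero]
  exact DFunLike.congr_fun (congrArg WithConv.ofConv hg) f

lemma SqZeroKer.mul_apply (hπ : SqZeroKer π) {q h : WithConv (A →ₐ[W] X)}
    (hq : mapPoints A π q = 1) (hh : mapPoints A π h = 1) (f : A) :
    (q * h).ofConv f =
      q.ofConv f + h.ofConv f - algebraMap W X (Coalgebra.counit (R := W) f) := by
  let d (g : WithConv (A →ₐ[W] X)) : WithConv (A →ₗ[W] X) := toConv g.ofConv.toLinearMap - 1
  have hd : d q * d h = 0 := by
    have hmul : LinearMap.mul' W X ∘ₗ TensorProduct.map (d q).ofConv (d h).ofConv = 0 := by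
      ext a b
      exact hπ _ _ (map_sub_counit_eq_zero hq a) (map_sub_counit_eq_zero hh b)
    apply WithConv.ofConv_injective
    change LinearMap.mul' W X ∘ₗ TensorProduct.map (d q).ofConv (d h).ofConv ∘ₗ
      Coalgebra.comul = 0
    rw [← LinearMap.comp_assoc, hmul, LinearMap.zero_comp]
  have hqh : toConv (q * h).ofConv.toLinearMap =
      toConv q.ofConv.toLinearMap + toConv h.ofConv.toLinearMap - 1 := by
    rw [← sub_eq_zero, ← hd, AlgHom.toLinearMap_convMul]
    simp only [d, sub_mul, mul_sub, one_mul, mul_one]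
    abel
  exact DFunLike.congr_fun (congrArg WithConv.ofConv hqh) f

lemma SqZeroKer.map_mul_sub_counit (hπ : SqZeroKer π) {y : WithConv (A →ₐ[W] X)}
    (hy : mapPoints A π y = 1) (a b : A) :
    y.ofConv (a * b) - algebraMap W X (Coalgebra.counit (R := W) (a * b)) =
      algebraMap W X (Coalgebra.counit (R := W) a) *
          (y.ofConv b - algebraMap W X (Coalgebra.counit (R := W) b)) +
        (y.ofConv a - algebraMap W X (Coalgebra.counit (R := W) a)) *
          algebraMap W X (Coalgebra.counit (R := W) b) := by
  have h := hπ _ _ (map_sub_counit_eq_zero hy a) (map_sub_counit_eq_zero hy b)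
  rw [map_mul, Bialgebra.counit_mul, map_mul]
  linear_combination h

/- By the Leibniz rule `y` is the counit plus a derivation. As the counit vanishes in nonzero
weights, scaling this derivation on each weight space separately preserves the Leibniz rule. -/
lemma SqZeroKer.exists_rescale (hπ : SqZeroKer π) {y : WithConv (A →ₐ[W] X)}
    (hy : mapPoints A π y = 1) (c : ℤ → W) :
    ∃ z : WithConv (A →ₐ[W] X), mapPoints A π z = 1 ∧ ∀ n, ∀ f ∈ weightSpace μ n,
      z.ofConv f = algebraMap W X (Coalgebra.counit (R := W) f) +
        c n • (y.ofConv f - algebraMap W X (Coalgebra.counit (R := W) f)) := by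
  let ε : A →ₐ[W] X := (1 : WithConv (A →ₐ[W] X)).ofConv
  let δ : A →ₗ[W] X := y.ofConv.toLinearMap - ε.toLinearMap
  have hδ (f) : δ f = y.ofConv f - ε f := rfl
  have hε {n} {f : A} (hf : f ∈ weightSpace μ n) (hn : n ≠ 0) : ε f = 0 :=
    (congrArg (algebraMap W X) (counit_eq_zero_of_mem hn hf)).trans (map_zero _)
  have hδδ (a b) : δ a * δ b = 0 :=
    hπ _ _ (map_sub_counit_eq_zero hy a) (map_sub_counit_eq_zero hy b)
  have h_one : (ε.toLinearMap + c 0 • δ) 1 = 1 := by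
    simp [hδ]
  have h_mul (m n) (a) (ha : a ∈ weightSpace μ m) (b) (hb : b ∈ weightSpace μ n) :
      (ε.toLinearMap + c (m + n) • δ) (a * b) =
        (ε.toLinearMap + c m • δ) a * (ε.toLinearMap + c n • δ) b := by
    have leibniz : δ (a * b) = ε a * δ b + δ a * ε b := hπ.map_mul_sub_counit hy a b
    have hl : c (m + n) • (ε a * δ b) = c n • (ε a * δ b) := by
      rcases eq_or_ne m 0 with rfl | hm
      · rw [zero_add]
      · rw [hε ha hm, zero_mul, smul_zero, smul_zero]
    have hr : c (m + n) • (δ a * ε b) = c m • (δ a * ε b) := by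
      rcases eq_or_ne n 0 with rfl | hn
      · rw [add_zero]
      · rw [hε hb hn, mul_zero, smul_zero, smul_zero]
    simp only [LinearMap.add_apply, LinearMap.smul_apply, AlgHom.toLinearMap_apply, leibniz,
      smul_add, hl, hr, map_mul, add_mul, mul_add, smul_mul_assoc, mul_smul_comm, hδδ, smul_zero]
    abel
  have hz {n} {f : A} (hf : f ∈ weightSpace μ n) :
      gradedLift (weightSpace μ) (fun n => ε.toLinearMap + c n • δ) h_one h_mul f =
        ε f + c n • δ f := gradedLift_of_mem hf
  refine ⟨toConv (gradedLift (weightSpace μ) _ h_one h_mul), ?_, fun n f hf => hz hf⟩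
  apply WithConv.ofConv_injective
  refine algHom_ext_of_homogeneous (𝒮 := weightSpace μ) fun n f hf => ?_
  rw [mapPoints_apply, hz hf, map_add, map_smul,
    show π (δ f) = 0 from map_sub_counit_eq_zero hy f, smul_zero, add_zero]
  exact π.commutes _

lemma SqZeroKer.exists_mul_eq (hπ : SqZeroKer π) {y : WithConv (A →ₐ[W] X)}
    (hy : mapPoints A π y = 1) :
    ∃ q ∈ minusSubgroup μ X, ∃ h ∈ unipSubgroup μ X, q * h = y := by
  obtain ⟨q, hq, hqf⟩ := hπ.exists_rescale (μ := μ) hy fun n => if n ≤ 0 then 1 else 0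
  obtain ⟨h, hh, hhf⟩ := hπ.exists_rescale (μ := μ) hy fun n => if n ≤ 0 then 0 else 1
  refine ⟨q, mem_minusSubgroup.mpr fun n hn f hf => ?_, h,
    mem_unipSubgroup.mpr fun n hn f hf => ?_, ?_⟩
  · rw [hqf n f hf, counit_eq_zero_of_mem hn.ne' hf, if_neg hn.not_ge, map_zero, zero_smul,
      add_zero]
  · rw [hhf n f hf, if_pos hn, zero_smul, add_zero]
  · apply WithConv.ofConv_injective
    refine algHom_ext_of_homogeneous (𝒮 := weightSpace μ) fun n f hf => ?_
    rw [hπ.mul_apply hq hh, hqf n f hf, hhf n f hf]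
    split_ifs <;> simp

lemma SqZeroKer.exists_mul_eq_of_mapPoints_eq [Algebra.FormallySmooth W A] (hπ : SqZeroKer π)
    (hsurj : Function.Surjective π) {g : WithConv (A →ₐ[W] X)} {q h : WithConv (A →ₐ[W] Y)}
    (hq : q ∈ minusSubgroup μ Y) (hh : h ∈ unipSubgroup μ Y) (hg : mapPoints A π g = q * h) :
    ∃ q ∈ minusSubgroup μ X, ∃ h ∈ unipSubgroup μ X, q * h = g := by
  obtain ⟨q', hq', rfl⟩ := exists_lift_mem_minusSubgroup hπ hsurj hq
  obtain ⟨h', hh', rfl⟩ := exists_lift_mem_unipSubgroup hπ hsurj hh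
  have hy : mapPoints A π (q'⁻¹ * g * h'⁻¹) = 1 := by
    rw [map_mul, map_mul, map_inv, map_inv, hg]
    group
  obtain ⟨q₁, hq₁, h₁, hh₁, e⟩ := hπ.exists_mul_eq (μ := μ) hy
  exact ⟨q' * q₁, mul_mem hq' hq₁, h₁ * h', mul_mem hh₁ hh', by
    rw [mul_assoc, ← mul_assoc q₁, e]
    group⟩

end Infinitesimal

/-! ### The morphism `P⁻ × U⁺ → G` -/

section BigCell

variable {W A X : Type*} [CommRing W] [CommRing A] [HopfAlgebra W A] [CommRing X] [Algebra W X]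
  (μ : A →ₐc[W] W[T;T⁻¹])

/-- The coordinate ring of `P⁻ × U⁺`, considered as an algebra over the coordinate ring of `G`
by the multiplication map. -/
def BigCell : Type _ :=
  (A ⧸ idealPMinus μ) ⊗[W] (A ⧸ idealUPlus μ)

namespace BigCell

instance : CommRing (BigCell μ) :=
  inferInstanceAs (CommRing ((A ⧸ idealPMinus μ) ⊗[W] (A ⧸ idealUPlus μ)))

instance : Algebra W (BigCell μ) :=
  inferInstanceAs (Algebra W ((A ⧸ idealPMinus μ) ⊗[W] (A ⧸ idealUPlus μ)))

/-- The universal point of `P⁻`. -/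
def minusPoint : WithConv (A →ₐ[W] BigCell μ) :=
  toConv ((Algebra.TensorProduct.includeLeft :
    A ⧸ idealPMinus μ →ₐ[W] (A ⧸ idealPMinus μ) ⊗[W] (A ⧸ idealUPlus μ)).comp
      (Ideal.Quotient.mkₐ W (idealPMinus μ)))

/-- The universal point of `U⁺`. -/
def unipPoint : WithConv (A →ₐ[W] BigCell μ) :=
  toConv ((Algebra.TensorProduct.includeRight :
    A ⧸ idealUPlus μ →ₐ[W] (A ⧸ idealPMinus μ) ⊗[W] (A ⧸ idealUPlus μ)).comp
      (Ideal.Quotient.mkₐ W (idealUPlus μ)))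

instance : Algebra A (BigCell μ) :=
  (minusPoint μ * unipPoint μ).ofConv.toRingHom.toAlgebra

instance : IsScalarTower W A (BigCell μ) :=
  .of_algebraMap_eq fun w => ((minusPoint μ * unipPoint μ).ofConv.commutes w).symm

lemma minusPoint_mem : minusPoint μ ∈ minusSubgroup μ (BigCell μ) := by
  refine mem_minusSubgroup_iff_idealPMinus.mpr fun f hf => ?_
  change (Ideal.Quotient.mk (idealPMinus μ) f) ⊗ₜ[W] (1 : A ⧸ idealUPlus μ) = 0
  rw [Ideal.Quotient.eq_zero_iff_mem.mpr hf, TensorProduct.zero_tmul]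

lemma unipPoint_mem : unipPoint μ ∈ unipSubgroup μ (BigCell μ) := by
  refine mem_unipSubgroup_iff_idealUPlus.mpr fun f hf => ?_
  change (1 : A ⧸ idealPMinus μ) ⊗ₜ[W] (Ideal.Quotient.mk (idealUPlus μ) f) = 0
  rw [Ideal.Quotient.eq_zero_iff_mem.mpr hf, TensorProduct.tmul_zero]

variable {μ}

lemma exists_mapPoints_eq {q h : WithConv (A →ₐ[W] X)} (hq : q ∈ minusSubgroup μ X)
    (hh : h ∈ unipSubgroup μ X) :
    ∃ φ : BigCell μ →ₐ[W] X, mapPoints A φ (minusPoint μ) = q ∧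
      mapPoints A φ (unipPoint μ) = h := by
  rw [mem_minusSubgroup_iff_idealPMinus] at hq
  rw [mem_unipSubgroup_iff_idealUPlus] at hh
  let φ : (A ⧸ idealPMinus μ) ⊗[W] (A ⧸ idealUPlus μ) →ₐ[W] X :=
    Algebra.TensorProduct.lift (Ideal.Quotient.liftₐ _ q.ofConv hq)
      (Ideal.Quotient.liftₐ _ h.ofConv hh) fun _ _ => .all _ _
  refine ⟨φ, ?_, ?_⟩
  · ext a
    change φ ((Ideal.Quotient.mk _ a) ⊗ₜ[W] 1) = _
    simp only [φ, Algebra.TensorProduct.lift_tmul, map_one, mul_one]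
    exact Ideal.Quotient.lift_mk _ _ _
  · ext a
    change φ (1 ⊗ₜ[W] (Ideal.Quotient.mk _ a)) = _
    simp only [φ, Algebra.TensorProduct.lift_tmul, map_one, one_mul]
    exact Ideal.Quotient.lift_mk _ _ _

lemma apply_algebraMap (φ : BigCell μ →ₐ[W] X) (a : A) :
    φ (algebraMap A (BigCell μ) a) =
      (mapPoints A φ (minusPoint μ) * mapPoints A φ (unipPoint μ)).ofConv a := by
  rw [← map_mul]
  rfl

lemma algHom_ext {φ ψ : BigCell μ →ₐ[W] X}
    (h : ∀ a, φ (algebraMap A (BigCell μ) a) = ψ (algebraMap A (BigCell μ) a)) : φ = ψ := by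
  have hmul : mapPoints A φ (minusPoint μ) * mapPoints A φ (unipPoint μ) =
      mapPoints A ψ (minusPoint μ) * mapPoints A ψ (unipPoint μ) := by
    ext a
    rw [← apply_algebraMap, ← apply_algebraMap, h]
  obtain ⟨hq, hh⟩ := eq_and_eq_of_mul_eq_mul (mapPoints_mem_minusSubgroup (minusPoint_mem μ) φ)
    (mapPoints_mem_minusSubgroup (minusPoint_mem μ) ψ)
    (mapPoints_mem_unipSubgroup (unipPoint_mem μ) φ)
    (mapPoints_mem_unipSubgroup (unipPoint_mem μ) ψ) hmul
  exact Algebra.TensorProduct.ext (Ideal.Quotient.algHom_ext _ (congrArg WithConv.ofConv hq))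
    (Ideal.Quotient.algHom_ext _ (congrArg WithConv.ofConv hh))

variable (μ)

instance formallySmooth [Algebra.FormallySmooth W A] : Algebra.FormallySmooth A (BigCell μ) := by
  refine .of_comp_surjective fun X _ _ I hI φ => ?_
  let _ : Algebra W X := Algebra.compHom X (algebraMap W A)
  have : IsScalarTower W A X := .of_algebraMap_eq fun _ => rfl
  have hπ : SqZeroKer (Ideal.Quotient.mkₐ W I) := fun x y hx hy => by
    have hxy := Ideal.mul_mem_mul (Ideal.Quotient.eq_zero_iff_mem.mp hx)
      (Ideal.Quotient.eq_zero_iff_mem.mp hy)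
    rwa [← pow_two, hI, Ideal.mem_bot] at hxy
  let φ' : BigCell μ →ₐ[W] X ⧸ I := φ.restrictScalars W
  have hg : mapPoints A (Ideal.Quotient.mkₐ W I) (toConv (IsScalarTower.toAlgHom W A X)) =
      mapPoints A φ' (minusPoint μ) * mapPoints A φ' (unipPoint μ) := by
    ext a
    rw [← apply_algebraMap]
    exact (φ.commutes a).symm
  obtain ⟨q, hq, h, hh, e⟩ := hπ.exists_mul_eq_of_mapPoints_eq Ideal.Quotient.mk_surjective
    (mapPoints_mem_minusSubgroup (minusPoint_mem μ) φ')
    (mapPoints_mem_unipSubgroup (unipPoint_mem μ) φ') hg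
  obtain ⟨ψ, rfl, rfl⟩ := exists_mapPoints_eq hq hh
  have hψ (a) : ψ (algebraMap A (BigCell μ) a) = algebraMap A X a := by
    rw [apply_algebraMap, e]
    rfl
  have hψφ : (Ideal.Quotient.mkₐ W I).comp ψ = φ' := algHom_ext fun a => by
    rw [AlgHom.comp_apply, hψ]
    exact (φ.commutes a).symm
  exact ⟨{ ψ with commutes' := hψ }, AlgHom.ext fun b => DFunLike.congr_fun hψφ b⟩

instance flat [IsNoetherianRing W] [Algebra.Smooth W A] : Module.Flat A (BigCell μ) := by
  have : IsNoetherianRing A := Algebra.FiniteType.isNoetherianRing W A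
  have (I : Ideal A) : Algebra.FiniteType W (A ⧸ I) :=
    .of_surjective (Ideal.Quotient.mkₐ W I) Ideal.Quotient.mk_surjective
  have : Algebra.FiniteType W ((A ⧸ idealPMinus μ) ⊗[W] (A ⧸ idealUPlus μ)) :=
    .trans (S := A ⧸ idealPMinus μ) inferInstance inferInstance
  have : Algebra.FiniteType W (BigCell μ) := this
  have : Algebra.FiniteType A (BigCell μ) := .of_restrictScalars_finiteType W A (BigCell μ)
  have : Algebra.FinitePresentation A (BigCell μ) :=
    Algebra.FinitePresentation.of_finiteType.mp inferInstance
  have : Algebra.Smooth A (BigCell μ) := {}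
  infer_instance

end BigCell

end BigCell

/-! ### Flat epimorphisms of graded rings -/

section FlatEpi

variable {R S C : Type*} [CommRing R] [CommRing S] [CommRing C] [Algebra R S] [Algebra R C]
variable [Algebra S C]

lemma torsionOf_map_eq_top [Module.Flat S C] {N : Type*} [AddCommGroup N] [Module S N] {x : N}
    (hx : (1 : C) ⊗ₜ[S] x = 0) : (Ideal.torsionOf S N x).map (algebraMap S C) = ⊤ := by
  let f : S ⧸ Ideal.torsionOf S N x →ₗ[S] N :=
    (Submodule.subtype _).comp (Ideal.quotTorsionOfEquivSpanSingleton S N x).toLinearMap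
  have hf : Function.Injective (f.lTensor C) := Module.Flat.lTensor_preserves_injective_linearMap f
    (Subtype.val_injective.comp (Ideal.quotTorsionOfEquivSpanSingleton S N x).injective)
  have hfx : f 1 = x := by
    change ((Ideal.quotTorsionOfEquivSpanSingleton S N x (Submodule.Quotient.mk 1)) : N) = x
    rw [Ideal.quotTorsionOfEquivSpanSingleton_apply_mk, one_smul]
  have h : (1 : C) ⊗ₜ[S] (1 : S ⧸ Ideal.torsionOf S N x) = 0 :=
    hf (by rw [LinearMap.lTensor_tmul, hfx, hx, map_zero])
  rw [Ideal.eq_top_iff_one, ← Ideal.Quotient.eq_zero_iff_mem,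
    ← (Algebra.TensorProduct.quotIdealMapEquivTensorQuot C _).map_eq_zero_iff]
  exact h

lemma torsionOf_algebraMap_map_eq_top [Module.Flat S C] {s : S} (hs : algebraMap S C s = 0) :
    (Ideal.torsionOf S S s).map (algebraMap S C) = ⊤ :=
  torsionOf_map_eq_top <| by
    rw [← mul_one s, ← smul_eq_mul, ← TensorProduct.smul_tmul, ← Algebra.algebraMap_eq_smul_one, hs,
      TensorProduct.zero_tmul]

lemma torsionOf_mkQ_map_eq_top [Module.Flat S C] [Algebra.IsEpi S C] (c : C) :
    (Ideal.torsionOf S _ ((LinearMap.range (Algebra.linearMap S C)).mkQ c)).map (algebraMap S C) =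
      ⊤ :=
  torsionOf_map_eq_top <| by
    have h := congrArg ((LinearMap.range (Algebra.linearMap S C)).mkQ.lTensor C)
      (Algebra.tmul_comm S 1 c)
    rw [LinearMap.lTensor_tmul, LinearMap.lTensor_tmul] at h
    have h_one : (LinearMap.range (Algebra.linearMap S C)).mkQ 1 = 0 :=
      (Submodule.Quotient.mk_eq_zero _).mpr ⟨1, map_one (algebraMap S C)⟩
    rw [h, h_one, TensorProduct.tmul_zero]

lemma algHom_ext_of_isEpi [IsScalarTower R S C] [Algebra.IsEpi S C] {X : Type*} [CommRing X]
    [Algebra R X] {φ ψ : C →ₐ[R] X}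
    (h : φ.comp (IsScalarTower.toAlgHom R S C) = ψ.comp (IsScalarTower.toAlgHom R S C)) :
    φ = ψ := by
  let _ : Algebra S X := (φ.comp (IsScalarTower.toAlgHom R S C)).toAlgebra
  let φ' : C →ₐ[S] X := { φ with commutes' := fun _ => rfl }
  let ψ' : C →ₐ[S] X := { ψ with commutes' := fun s => (DFunLike.congr_fun h s).symm }
  ext c
  have hc := congrArg (Algebra.TensorProduct.lift φ' ψ' fun _ _ => .all _ _)
    (Algebra.tmul_comm S 1 c)
  simp only [Algebra.TensorProduct.lift_tmul, map_one, one_mul, mul_one] at hc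
  exact hc.symm

end FlatEpi

section GradedFlatEpi

variable {R S C : Type*} [CommRing R] [CommRing S] [CommRing C] [Algebra R S] [Algebra R C]
variable [Algebra S C] [IsScalarTower R S C]
variable {𝒮 : ℤ → Submodule R S} [GradedAlgebra 𝒮] {ρ : C →ₐ[R] C[T;T⁻¹]}

lemma coeff_algebraMap (hρ : ∀ n, ∀ s ∈ 𝒮 n, algebraMap S C s ∈ coactionWeight ρ n) (s : S)
    (n : ℤ) :
    (ρ (algebraMap S C s)).coeff n = algebraMap S C (DirectSum.decompose 𝒮 s n) := by
  have h : ρ.comp (IsScalarTower.toAlgHom R S C) =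
      (AddMonoidAlgebra.mapAlgHom ℤ (IsScalarTower.toAlgHom R S C)).comp (gradedCoaction 𝒮) :=
    algHom_ext_of_homogeneous fun n s hs => by
      rw [AlgHom.comp_apply, AlgHom.comp_apply, gradedCoaction_of_mem hs,
        AddMonoidAlgebra.mapAlgHom_single]
      exact hρ n s hs
  have hs := congrArg (fun p => p.coeff n) (DFunLike.congr_fun h s)
  rwa [AlgHom.comp_apply, AlgHom.comp_apply, AddMonoidAlgebra.coeff_mapAlgHom,
    coeff_gradedCoaction] at hs

lemma isCoaction_of_isEpi [Algebra.IsEpi S C]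
    (hρ : ∀ n, ∀ s ∈ 𝒮 n, algebraMap S C s ∈ coactionWeight ρ n) : IsCoaction ρ where
  counit := algHom_ext_of_isEpi (S := S) <| algHom_ext_of_homogeneous fun n s hs => by
    change laurentEvalOne R C (ρ (algebraMap S C s)) = algebraMap S C s
    rw [mem_coactionWeight.mp (hρ n s hs), laurentEvalOne_single]
  coassoc := algHom_ext_of_isEpi (S := S) <| algHom_ext_of_homogeneous fun n s hs => by
    change AddMonoidAlgebra.mapAlgHom ℤ ρ (ρ (algebraMap S C s)) =
      laurentDiag R C (ρ (algebraMap S C s))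
    rw [mem_coactionWeight.mp (hρ n s hs), AddMonoidAlgebra.mapAlgHom_single, laurentDiag_single]
    exact congrArg _ (hρ n s hs)

lemma isHomogeneous_torsionOf {n : ℤ} {s : S} (hs : s ∈ 𝒮 n) :
    (Ideal.torsionOf S S s).IsHomogeneous 𝒮 := fun i r hr => by
  rw [Ideal.mem_torsionOf_iff, smul_eq_mul] at *
  rw [← DirectSum.coe_decompose_mul_add_of_right_mem 𝒮 hs, hr]
  simp

lemma isHomogeneous_torsionOf_mkQ (hρ : ∀ n, ∀ s ∈ 𝒮 n, algebraMap S C s ∈ coactionWeight ρ n)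
    {n : ℤ} {c : C} (hc : c ∈ coactionWeight ρ n) :
    (Ideal.torsionOf S _ ((LinearMap.range (Algebra.linearMap S C)).mkQ c)).IsHomogeneous 𝒮 := by
  have hmem (s : S) :
      s ∈ Ideal.torsionOf S _ ((LinearMap.range (Algebra.linearMap S C)).mkQ c) ↔
        ∃ r, algebraMap S C r = algebraMap S C s * c := by
    rw [Ideal.mem_torsionOf_iff, ← map_smul, Submodule.mkQ_apply, Submodule.Quotient.mk_eq_zero,
      Algebra.smul_def]
    rfl
  intro i s hs
  rw [hmem] at hs ⊢
  obtain ⟨r, hr⟩ := hs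
  refine ⟨DirectSum.decompose 𝒮 r (i + n), ?_⟩
  rw [← coeff_algebraMap hρ, hr, map_mul, mem_coactionWeight.mp hc,
    AddMonoidAlgebra.coeff_mul_single_eq_coeff_mul i fun m _ => add_left_inj n,
    coeff_algebraMap hρ]

lemma algebraMap_bijective_of_flat_of_isEpi [Module.Flat S C] [Algebra.IsEpi S C]
    (hρ : ∀ n, ∀ s ∈ 𝒮 n, algebraMap S C s ∈ coactionWeight ρ n)
    (hI : ∀ I : Ideal S, I.IsHomogeneous 𝒮 → I.map (algebraMap S C) = ⊤ → I = ⊤) :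
    Function.Bijective (algebraMap S C) := by
  constructor
  · refine (injective_iff_map_eq_zero _).mpr fun s hs => ?_
    have hcomp (n : ℤ) : (DirectSum.decompose 𝒮 s n : S) = 0 := by
      rw [← Ideal.torsionOf_eq_top_iff (R := S)]
      refine hI _ (isHomogeneous_torsionOf (SetLike.coe_mem _)) (torsionOf_algebraMap_map_eq_top ?_)
      rw [← coeff_algebraMap hρ, hs, map_zero, AddMonoidAlgebra.coeff_zero, Finsupp.zero_apply]
    classical
    rw [← DirectSum.sum_support_decompose 𝒮 s]
    exact Finset.sum_eq_zero fun n _ => hcomp n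
  · have hweight (n : ℤ) {c : C} (hc : c ∈ coactionWeight ρ n) :
        c ∈ LinearMap.range (Algebra.linearMap S C) := by
      rw [← Submodule.Quotient.mk_eq_zero, ← Submodule.mkQ_apply,
        ← Ideal.torsionOf_eq_top_iff (R := S)]
      exact hI _ (isHomogeneous_torsionOf_mkQ hρ hc) (torsionOf_mkQ_map_eq_top c)
    have hcoaction := isCoaction_of_isEpi hρ
    intro c
    rw [← hcoaction.sum_coeff c]
    exact Submodule.sum_mem _ fun n _ => hweight n (hcoaction.coeff_mem c n)

end GradedFlatEpi

/-! ### Frames -/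

section Frame

variable {S E : Type*} [CommRing S] [SetLike E S] [AddSubgroupClass E S]
variable (𝒮 : ℤ → E)

/-- The ideal generated by the homogeneous elements of nonzero degree. It defines the fixed points
of the action of `𝔾ₘ` on `Spec S`. -/
def nonzeroDegreeIdeal : Ideal S :=
  Ideal.span {s | ∃ n ≠ 0, s ∈ 𝒮 n}

variable {𝒮} [GradedRing 𝒮] {F : PreFrame 𝒮} {p : ℕ}

namespace PreFrame.IsFrame

lemma mem_jacobson_of_σ_mem (hF : F.IsFrame p) {x : 𝒮 0}
    (hx : F.σ (x : S) ∈ Ideal.jacobson (⊥ : Ideal (𝒮 0))) :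
    x ∈ Ideal.jacobson (⊥ : Ideal (𝒮 0)) := by
  have hfrob : F.σ (x : S) - x ^ p ∈ Ideal.jacobson (⊥ : Ideal (𝒮 0)) :=
    (Ideal.span_singleton_le_iff_mem _).mpr hF.p_mem_rad (hF.σ_frobenius x)
  have hpow : x ^ p ∈ Ideal.jacobson (⊥ : Ideal (𝒮 0)) := by
    simpa using sub_mem hx hfrob
  exact Ideal.isRadical_jacobson ⊥ ⟨p, hpow⟩

lemma exists_eq_mul_pow (hF : F.IsFrame p) : ∃ t ∈ 𝒮 (-1), F.σ t = p ∧
    ∀ n : ℕ, 0 < n → ∀ b ∈ 𝒮 (-(n : ℤ)), b = t ^ n * (F.τ b : 𝒮 0) := by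
  obtain ⟨t, hτ, hσ⟩ := hF.σ_t
  refine ⟨t, t.2, hσ, fun n hn b hb => ?_⟩
  have hmem : (t : S) ^ n * (F.τ b : 𝒮 0) ∈ 𝒮 (-(n : ℤ)) := by
    simpa using SetLike.mul_mem_graded (SetLike.pow_mem_graded n t.2) (F.τ b).2
  have h := (hF.τ_neg_bijective n hn).injective (a₁ := ⟨b, hb⟩) (a₂ := ⟨_, hmem⟩)
    (by simp [hτ, hF.τ_zero])
  exact congrArg Subtype.val h

lemma mul_mem_jacobson (hF : F.IsFrame p) {n : ℤ} (hn : n ≠ 0) {a b : S} (ha : a ∈ 𝒮 n)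
    (hb : b ∈ 𝒮 (-n)) {x : 𝒮 0} (hx : (x : S) = a * b) :
    x ∈ Ideal.jacobson (⊥ : Ideal (𝒮 0)) := by
  wlog hpos : 0 < n generalizing n a b
  · exact this (neg_ne_zero.mpr hn) hb (by rwa [neg_neg]) (hx.trans (mul_comm a b)) (by omega)
  lift n to ℕ using hpos.le
  obtain ⟨t, ht, hσ, h⟩ := hF.exists_eq_mul_pow
  have hmem : a * t ^ n ∈ 𝒮 0 := by
    simpa using SetLike.mul_mem_graded ha (SetLike.pow_mem_graded n ht)
  let y : 𝒮 0 := ⟨a * t ^ n, hmem⟩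
  have hxy : x = y * F.τ b := by
    ext
    refine hx.trans ((congrArg (a * ·) (h n (by omega) b hb)).trans ?_)
    exact (mul_assoc ..).symm
  rw [hxy]
  refine Ideal.mul_mem_right _ _ (hF.mem_jacobson_of_σ_mem ?_)
  rw [map_mul, map_pow, hσ]
  exact Ideal.mul_mem_left _ _ (Ideal.pow_mem_of_mem _ hF.p_mem_rad n (by omega))

lemma decompose_mem_jacobson (hF : F.IsFrame p) {s : S} (hs : s ∈ nonzeroDegreeIdeal 𝒮) :
    DirectSum.decompose 𝒮 s 0 ∈ Ideal.jacobson (⊥ : Ideal (𝒮 0)) := by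
  suffices h : ∀ r, DirectSum.decompose 𝒮 (r * s) 0 ∈ Ideal.jacobson (⊥ : Ideal (𝒮 0)) by
    simpa using h 1
  induction hs using Submodule.span_induction with
  | mem s hs =>
    obtain ⟨n, hn, hs⟩ := hs
    intro r
    refine hF.mul_mem_jacobson (neg_ne_zero.mpr hn) (SetLike.coe_mem (DirectSum.decompose 𝒮 r _))
      (by rwa [neg_neg]) ?_
    rw [← DirectSum.coe_decompose_mul_add_of_right_mem 𝒮 hs, neg_add_cancel]
  | zero => simp
  | add s t _ _ hs ht =>
    intro r
    rw [mul_add, DirectSum.decompose_add]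
    exact add_mem (hs r) (ht r)
  | smul a s _ hs =>
    intro r
    rw [smul_eq_mul, ← mul_assoc]
    exact hs _

lemma eq_top_of_sup_nonzeroDegreeIdeal_eq_top (hF : F.IsFrame p) {I : Ideal S}
    (hI : I.IsHomogeneous 𝒮) (h : I ⊔ nonzeroDegreeIdeal 𝒮 = ⊤) : I = ⊤ := by
  obtain ⟨i, hi, j, hj, hij⟩ := Submodule.mem_sup.mp ((Ideal.eq_top_iff_one _).mp h)
  have hsub : DirectSum.decompose 𝒮 i 0 - 1 = -DirectSum.decompose 𝒮 j 0 := by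
    rw [sub_eq_iff_eq_add', ← sub_eq_add_neg, eq_sub_iff_add_eq, ← DirectSum.add_apply,
      ← DirectSum.decompose_add, hij, DirectSum.decompose_one]
    rfl
  have hunit : IsUnit (DirectSum.decompose 𝒮 i 0) :=
    Ideal.isUnit_of_sub_one_mem_jacobson_bot _ (hsub ▸ neg_mem (hF.decompose_mem_jacobson hj))
  exact Ideal.eq_top_of_isUnit_mem I (hI 0 hi)
    (hunit.map (SetLike.GradeZero.subring 𝒮).subtype)

end PreFrame.IsFrame

end Frame

/-! ### Decomposition of equivariant points -/

section Equivariant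

variable {W A X : Type*} [CommRing W] [CommRing A] [HopfAlgebra W A] [CommRing X] [Algebra W X]
variable {μ : A →ₐc[W] W[T;T⁻¹]}

lemma twist_mem_minusSubgroup {g : WithConv (A →ₐ[W] X)} (hg : g ∈ minusSubgroup μ X) :
    twist μ X g ∈ minusSubgroup μ X[T;T⁻¹] :=
  mem_minusSubgroup.mpr fun n hn f hf => by
    rw [twist_apply_of_mem g hf, mem_minusSubgroup.mp hg n hn f hf, AddMonoidAlgebra.single_zero]

lemma twist_mem_unipSubgroup {g : WithConv (A →ₐ[W] X)} (hg : g ∈ unipSubgroup μ X) :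
    twist μ X g ∈ unipSubgroup μ X[T;T⁻¹] :=
  mem_unipSubgroup.mpr fun n hn f hf => by
    rw [twist_apply_of_mem g hf, mem_unipSubgroup.mp hg n hn f hf]
    rcases hn.lt_or_eq with hn | rfl
    · rw [counit_eq_zero_of_mem hn.ne hf, map_zero, map_zero, AddMonoidAlgebra.single_zero]
    · rfl

variable {𝒮 : ℤ → Submodule W X} [GradedAlgebra 𝒮]

lemma mem_displayGroup_iff {g : WithConv (A →ₐ[W] X)} :
    g ∈ displayGroup μ 𝒮 ↔ mapPoints A (gradedCoaction 𝒮) g = twist μ X g := by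
  refine ⟨fun hg => ?_, fun hg n f hf => ?_⟩
  · apply WithConv.ofConv_injective
    refine algHom_ext_of_homogeneous (𝒮 := weightSpace μ) fun n f hf => ?_
    rw [twist_apply_of_mem g hf, mapPoints_apply, gradedCoaction_of_mem (hg n f hf)]
  · rw [mem_iff_gradedCoaction_eq, ← mapPoints_apply, hg, twist_apply_of_mem g hf]

lemma mem_displayGroup_of_mul_mem {q h : WithConv (A →ₐ[W] X)} (hq : q ∈ minusSubgroup μ X)
    (hh : h ∈ unipSubgroup μ X) (hqh : q * h ∈ displayGroup μ 𝒮) :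
    q ∈ displayGroup μ 𝒮 ∧ h ∈ displayGroup μ 𝒮 := by
  simp only [mem_displayGroup_iff] at hqh ⊢
  rw [map_mul, map_mul] at hqh
  exact eq_and_eq_of_mul_eq_mul (mapPoints_mem_minusSubgroup hq _) (twist_mem_minusSubgroup hq)
    (mapPoints_mem_unipSubgroup hh _) (twist_mem_unipSubgroup hh) hqh

end Equivariant

section Pullback

variable {W A S X : Type*} [CommRing W] [CommRing A] [HopfAlgebra W A] [CommRing S] [Algebra W S]
  [Algebra A S] [IsScalarTower W A S] [CommRing X] [Algebra W X]
variable (μ : A →ₐc[W] W[T;T⁻¹])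

variable (W A S) in
/-- The point of `G` defined by an algebra over its coordinate ring. -/
def structurePoint : WithConv (A →ₐ[W] S) :=
  toConv (IsScalarTower.toAlgHom W A S)

variable (S) in
/-- The projection to `P⁻ × U⁺` of its pullback along `Spec S → G`. -/
def pullbackProj : BigCell μ →ₐ[W] S ⊗[A] BigCell μ :=
  (Algebra.TensorProduct.includeRight : BigCell μ →ₐ[A] S ⊗[A] BigCell μ).restrictScalars W

lemma pullbackProj_algebraMap (a : A) :
    pullbackProj S μ (algebraMap A (BigCell μ) a) =
      algebraMap S (S ⊗[A] BigCell μ) (algebraMap A S a) :=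
  (AlgHom.commutes (Algebra.TensorProduct.includeRight : BigCell μ →ₐ[A] _) a).trans
    (IsScalarTower.algebraMap_apply A S (S ⊗[A] BigCell μ) a)

lemma mapPoints_pullbackProj_mul :
    mapPoints A (pullbackProj S μ) (BigCell.minusPoint μ) *
        mapPoints A (pullbackProj S μ) (BigCell.unipPoint μ) =
      mapPoints A (IsScalarTower.toAlgHom W S (S ⊗[A] BigCell μ)) (structurePoint W A S) := by
  ext a
  rw [← BigCell.apply_algebraMap]
  exact pullbackProj_algebraMap μ a

variable {μ}

lemma exists_pullback_lift (χ : S →ₐ[W] X) {q h : WithConv (A →ₐ[W] X)}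
    (hq : q ∈ minusSubgroup μ X) (hh : h ∈ unipSubgroup μ X)
    (e : q * h = mapPoints A χ (structurePoint W A S)) :
    ∃ Φ : S ⊗[A] BigCell μ →ₐ[W] X, Φ.comp (IsScalarTower.toAlgHom W S _) = χ := by
  obtain ⟨φ, rfl, rfl⟩ := BigCell.exists_mapPoints_eq hq hh
  let _ : Algebra A X := (χ.toRingHom.comp (algebraMap A S)).toAlgebra
  let χ' : S →ₐ[A] X := { χ with commutes' := fun _ => rfl }
  let φ' : BigCell μ →ₐ[A] X :=
    { φ with
      commutes' := fun a => (BigCell.apply_algebraMap φ a).trans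
        (congrArg (fun g => g.ofConv a) e) }
  have : IsScalarTower W A X := .of_algebraMap_eq fun w => by
    rw [← χ.commutes, IsScalarTower.algebraMap_apply W A S]
    rfl
  refine ⟨(Algebra.TensorProduct.lift χ' φ' fun _ _ => .all _ _).restrictScalars W, ?_⟩
  ext s
  change Algebra.TensorProduct.lift χ' φ' (fun _ _ => .all _ _) (s ⊗ₜ[A] 1) = χ s
  rw [Algebra.TensorProduct.lift_tmul, map_one, mul_one]
  rfl

lemma sup_nonzeroDegreeIdeal_eq_top_of_map_eq_top {𝒮 : ℤ → Submodule W S}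
    (hS : structurePoint W A S ∈ displayGroup μ 𝒮) {I : Ideal S}
    (hI : I.map (algebraMap S (S ⊗[A] BigCell μ)) = ⊤) :
    I ⊔ nonzeroDegreeIdeal 𝒮 = ⊤ := by
  let χ := Ideal.Quotient.mkₐ W (nonzeroDegreeIdeal 𝒮)
  have hχ : mapPoints A χ (structurePoint W A S) ∈ minusSubgroup μ _ :=
    mem_minusSubgroup.mpr fun n hn f hf =>
      Ideal.Quotient.eq_zero_iff_mem.mpr (Ideal.subset_span ⟨n, hn.ne', hS n f hf⟩)
  obtain ⟨Φ, hΦ⟩ := exists_pullback_lift χ hχ (one_mem (unipSubgroup μ _)) (mul_one _)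
  have hmap : I.map (Ideal.Quotient.mk (nonzeroDegreeIdeal 𝒮)) = ⊤ := by
    change I.map χ.toRingHom = ⊤
    rw [← hΦ]
    change I.map (Φ.toRingHom.comp (algebraMap S (S ⊗[A] BigCell μ))) = ⊤
    rw [← Ideal.map_map, hI, Ideal.map_top]
  have hcomap := Ideal.comap_map_of_surjective _
    (Ideal.Quotient.mk_surjective (I := nonzeroDegreeIdeal 𝒮)) I
  rw [hmap, Ideal.comap_top, ← RingHom.ker_eq_comap_bot, Ideal.mk_ker] at hcomap
  exact hcomap.symm

variable (μ)

instance isEpi_pullback : Algebra.IsEpi S (S ⊗[A] BigCell μ) := by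
  rw [Algebra.isEpi_iff_forall_one_tmul_eq]
  let C := S ⊗[A] BigCell μ
  let l : C →ₐ[S] C ⊗[S] C := Algebra.TensorProduct.includeLeft
  let r : C →ₐ[S] C ⊗[S] C := Algebra.TensorProduct.includeRight
  have hB : (l.restrictScalars W).comp (pullbackProj S μ) =
      (r.restrictScalars W).comp (pullbackProj S μ) := BigCell.algHom_ext fun a => by
    change l (pullbackProj S μ _) = r (pullbackProj S μ _)
    rw [pullbackProj_algebraMap, AlgHom.commutes, AlgHom.commutes]
  have hlr : l = r := Algebra.TensorProduct.ext (Subsingleton.elim _ _) <| by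
    ext b
    exact DFunLike.congr_fun hB b
  exact fun c => (DFunLike.congr_fun hlr c).symm

end Pullback

section Frame

variable {W A S : Type*} [CommRing W] [CommRing A] [HopfAlgebra W A] [CommRing S] [Algebra W S]
  {μ : A →ₐc[W] W[T;T⁻¹]} {𝒮 : ℤ → Submodule W S} [GradedAlgebra 𝒮]

section Pullback

variable [Algebra A S] [IsScalarTower W A S]

lemma exists_pullback_coaction (hS : structurePoint W A S ∈ displayGroup μ 𝒮) :
    ∃ ρ : S ⊗[A] BigCell μ →ₐ[W] (S ⊗[A] BigCell μ)[T;T⁻¹],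
      ∀ n, ∀ s ∈ 𝒮 n, algebraMap S (S ⊗[A] BigCell μ) s ∈ coactionWeight ρ n := by
  let ι := IsScalarTower.toAlgHom W S (S ⊗[A] BigCell μ)
  obtain ⟨ρ, hρ⟩ := exists_pullback_lift ((AddMonoidAlgebra.mapAlgHom ℤ ι).comp (gradedCoaction 𝒮))
    (twist_mem_minusSubgroup
      (mapPoints_mem_minusSubgroup (BigCell.minusPoint_mem μ) (pullbackProj S μ)))
    (twist_mem_unipSubgroup
      (mapPoints_mem_unipSubgroup (BigCell.unipPoint_mem μ) (pullbackProj S μ))) (by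
    rw [← map_mul, mapPoints_pullbackProj_mul, ← mapPoints_twist, ← mem_displayGroup_iff.mp hS]
    rfl)
  refine ⟨ρ, fun n s hs => ?_⟩
  have h := DFunLike.congr_fun hρ s
  rw [AlgHom.comp_apply, AlgHom.comp_apply, gradedCoaction_of_mem hs,
    AddMonoidAlgebra.mapAlgHom_single] at h
  exact h

lemma PreFrame.IsFrame.bijective_algebraMap_pullback [IsNoetherianRing W] [Algebra.Smooth W A]
    {F : PreFrame 𝒮} {p : ℕ} (hF : F.IsFrame p) (hS : structurePoint W A S ∈ displayGroup μ 𝒮) :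
    Function.Bijective (algebraMap S (S ⊗[A] BigCell μ)) := by
  obtain ⟨ρ, hρ⟩ := exists_pullback_coaction hS
  exact algebraMap_bijective_of_flat_of_isEpi hρ fun I hI hmap =>
    hF.eq_top_of_sup_nonzeroDegreeIdeal_eq_top hI
      (sup_nonzeroDegreeIdeal_eq_top_of_map_eq_top hS hmap)

end Pullback

lemma PreFrame.IsFrame.exists_mul_eq [IsNoetherianRing W] [Algebra.Smooth W A] {F : PreFrame 𝒮}
    {p : ℕ} (hF : F.IsFrame p) {g : WithConv (A →ₐ[W] S)} (hg : g ∈ displayGroup μ 𝒮) :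
    ∃ q ∈ minusSubgroup μ S, ∃ h ∈ unipSubgroup μ S, q * h = g := by
  let _ : Algebra A S := g.ofConv.toRingHom.toAlgebra
  have : IsScalarTower W A S := .of_algebraMap_eq fun w => (g.ofConv.commutes w).symm
  let e : S ≃ₐ[S] S ⊗[A] BigCell μ := .ofBijective (Algebra.ofId S _)
    (hF.bijective_algebraMap_pullback (show structurePoint W A S ∈ displayGroup μ 𝒮 from hg))
  let ψ : S ⊗[A] BigCell μ →ₐ[W] S := e.symm.toAlgHom.restrictScalars W
  refine ⟨_, mapPoints_mem_minusSubgroup (BigCell.minusPoint_mem μ) (ψ.comp (pullbackProj S μ)), _,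
    mapPoints_mem_unipSubgroup (BigCell.unipPoint_mem μ) (ψ.comp (pullbackProj S μ)), ?_⟩
  rw [← mapPoints_mapPoints, ← mapPoints_mapPoints, ← map_mul, mapPoints_pullbackProj_mul]
  ext a
  exact e.symm_apply_apply _

end Frame

end GDisplay

end

theorem proposition5_general {W A S : Type*} [CommRing W] [IsNoetherianRing W] [CommRing A]
    [HopfAlgebra W A] [Algebra.Smooth W A] (μ : A →ₐc[W] W[T;T⁻¹]) [CommRing S] [Algebra W S]
    (𝒮 : ℤ → Submodule W S) [GradedAlgebra 𝒮] {p : ℕ} {F : GDisplay.PreFrame 𝒮}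
    (hF : F.IsFrame p) :
    Set.BijOn (fun x : WithConv (A →ₐ[W] S) × WithConv (A →ₐ[W] S) => x.1 * x.2)
      (GDisplay.PMinus μ 𝒮 ×ˢ GDisplay.UPlus μ 𝒮) (GDisplay.displayGroup μ 𝒮) := by
  refine ⟨?mapsTo, ?injOn, ?surjOn⟩
  case mapsTo =>
    rintro ⟨q, h⟩ ⟨⟨hq, -⟩, ⟨hh, -⟩⟩
    exact GDisplay.mem_displaySubgroup.mp
      (mul_mem (GDisplay.mem_displaySubgroup.mpr hq) (GDisplay.mem_displaySubgroup.mpr hh))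
  case injOn =>
    rintro ⟨q, h⟩ ⟨⟨-, hq⟩, ⟨-, hh⟩⟩ ⟨q', h'⟩ ⟨⟨-, hq'⟩, ⟨-, hh'⟩⟩ e
    rw [← GDisplay.mem_minusSubgroup_iff_idealPMinus] at hq hq'
    rw [← GDisplay.mem_unipSubgroup_iff_idealUPlus] at hh hh'
    exact Prod.ext_iff.mpr (GDisplay.eq_and_eq_of_mul_eq_mul hq hq' hh hh' e)
  case surjOn =>
    intro g hg
    obtain ⟨q, hq, h, hh, rfl⟩ := hF.exists_mul_eq hg
    obtain ⟨hqS, hhS⟩ := GDisplay.mem_displayGroup_of_mul_mem hq hh hg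
    exact ⟨(q, h), ⟨⟨hqS, GDisplay.mem_minusSubgroup_iff_idealPMinus.mp hq⟩,
      ⟨hhS, GDisplay.mem_unipSubgroup_iff_idealUPlus.mp hh⟩⟩, rfl⟩

theorem proposition5 (p : ℕ) [Fact p.Prime]
    (k : Type*) [Field k] [Finite k] [CharP k p]
    (A' : Type*) [CommRing A'] [HopfAlgebra ℤ_[p] A'] [Algebra.Smooth ℤ_[p] A']
    (μ : (WittVector p k ⊗[ℤ_[p]] A') →ₐc[WittVector p k] (WittVector p k)[T;T⁻¹])
    (S : Type*) [CommRing S] [Algebra (WittVector p k) S]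
    (𝒮 : ℤ → Submodule (WittVector p k) S) [GradedAlgebra 𝒮]
    (F : GDisplay.PreFrame 𝒮) (hF : F.IsFrameOverWitt p) :
    Set.BijOn
      (fun x : WithConv ((WittVector p k ⊗[ℤ_[p]] A') →ₐ[WittVector p k] S) ×
          WithConv ((WittVector p k ⊗[ℤ_[p]] A') →ₐ[WittVector p k] S) => x.1 * x.2)
      (GDisplay.PMinus μ 𝒮 ×ˢ GDisplay.UPlus μ 𝒮)
      (GDisplay.displayGroup μ 𝒮) :=
  proposition5_general μ 𝒮 hF.toIsFrame
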